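/- For integers $k\ge 3$ and $s\ge 0$ define $g_k(s)$ recursively by $g_k(s)=0$ for $0\le s<k$ and, for $s\ge k$, $$g_k(s)=\max\Bigl\{\sum_{i=1}^k g_k(s_i)+\prod_{i=1}^k s_i\Bigr\},$$ where the maximum is over all $k$-tuples of integers $s_1,\dots,s_k$ with $s_1+\cdots+s_k=s$ and $0\le s_i<s$ for every $i$. Let $\binom{[k]}{2}$ denote the set of two-element subsets of $[k]=\{1,\dots,k\}$. For tournaments $R$ and $H$ whose edges are colored from $\binom{[k]}{2}$, a copy of $R$ in $H$ is a set $K$ of vertices of $H$ such that there is a bijection from $V(R)$ to $K$ that preserves the orientation and the color of every edge. Theorem. Let $s\ge k\ge 4$, and let $R$ be an arbitrary $k$-vertex tournament whose $\binom{k}{2}$ edges are colored with the $\binom{k}{2}$ distinct colors from $\binom{[k]}{2}$ (each color is used exactly once). Then the number of copies of $R$ in any $s$-vertex tournament whose edges are colored from $\binom{[k]}{2}$ is at most $g_k(s)$. -/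

import Mathlib

/-- A digraph is a tournament if it has no loops and, between any two distinct vertices, exactly
one of the two possible arcs is present. -/
structure Digraph.IsTournament {V : Type*} (G : Digraph V) : Prop where
  loopless : ∀ v, ¬ G.Adj v v
  oriented : ∀ v w, v ≠ w → Xor (G.Adj v w) (G.Adj w v)

/-- A tournament on the vertex set `V` together with an assignment of a color from `C` to each of
its edges. Each edge of a tournament joins a unique unordered pair of distinct vertices, so the
coloring is a labeling of the edges of the complete graph on `V`. -/
structure ColoredTournament (V C : Type*) where
  /-- The underlying digraph. -/
  digraph : Digraph V
  isTournament : digraph.IsTournament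
  /-- The edge coloring. -/
  color : SimpleGraph.TopEdgeLabeling V C

namespace ColoredTournament

variable {V W C : Type*}

/-- The edge-colored subtournament induced on a set `S` of vertices. -/
def induce (H : ColoredTournament V C) (S : Set V) : ColoredTournament S C where
  digraph := ⟨fun v w => H.digraph.Adj v w⟩
  isTournament :=
    ⟨fun v => H.isTournament.loopless v,
      fun v w hvw => H.isTournament.oriented v w (fun h => hvw (Subtype.ext h))⟩
  color := H.color.pullback (Function.Embedding.subtype (· ∈ S))

/-- A bijection between the vertex sets is an isomorphism of edge-colored tournaments if it
preserves the orientation and the color of every edge. -/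
def IsIso (R : ColoredTournament W C) (H : ColoredTournament V C) (f : W ≃ V) : Prop :=
  (∀ v w, R.digraph.Adj v w ↔ H.digraph.Adj (f v) (f w)) ∧
    ∀ (v w : W) (h : v ≠ w), H.color.get (f v) (f w) (f.injective.ne h) = R.color.get v w h

/-- The copies of `R` in `H`: the sets of vertices of `H` that induce an edge-colored tournament
isomorphic to `R`. -/
def copies (R : ColoredTournament W C) (H : ColoredTournament V C) : Set (Set V) :=
  {S | ∃ f : W ≃ S, R.IsIso (H.induce S) f}

/-- The edges of the tournament have pairwise distinct colors. -/
def IsRainbow (R : ColoredTournament W C) : Prop :=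
  Function.Injective R.color

end ColoredTournament

/-- The Erdős–Hajnal recursive partition function `g_k(s)`: it is `0` for `s < k`, and for `s ≥ k`
it is the maximum of `∑ i, g_k(p i) + ∏ i, p i` over all `p = (p 1, …, p k)` with `∑ i, p i = s` and
`0 ≤ p i < s` for all `i`. -/
def erdosHajnalG (k s : ℕ) : ℕ :=
  if s < k then 0
  else
    (Finset.univ.filter fun p : Fin k → Fin s => ∑ i, (p i : ℕ) = s).sup fun p =>
      ∑ i, erdosHajnalG k (p i) + ∏ i, (p i : ℕ)
termination_by s
decreasing_by exact (p i).isLt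

/-- The set of colors: the two-element subsets of a `k`-element set. -/
abbrev PairColor (k : ℕ) : Type :=
  {c : Finset (Fin k) // c.card = 2}

/-!
The number of copies is bounded by the number of copies in a balanced iterated blow-up, which is
the balanced choice in every step of the recursion for `erdosHajnalG`.

Since `R` is rainbow, the color and the orientation of an edge `v w` of `H` determine the vertex
`a v w` of `R` that `v` can represent in a copy containing `w`. So `H` may be replaced by a role
assignment `a : V → V → ι` with `k` roles, and copies by the tuples `τ : ι → V` with
`a (τ i) (τ j) = i` for all `i ≠ j` (`roleCopies`). The vertices towards which `v` plays the role
`i` are split by their own roles towards `v`, so a vertex with `x i` such neighbors is in at most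
`∑ i, p (x i)` copies, where `p = balProd (k - 1)` is the largest product of `k - 1` natural numbers
with a given sum.

The bound `blowupCount` is proved by induction on the number `s` of vertices. Take an assignment
with the maximum number of copies, and suppose it has more than `blowupCount (k - 1) s` of them.

* Deleting a vertex shows that every vertex is in more than `p (n - n / k)` copies, `n = s - 1`. As
  `p` is convex, for `k ≥ 4` this forces every vertex `v` to play one role `d v` towards all but
  about `n / k` vertices (`exists_dominant_role`). For `k = 3` this step would fail, since two roles
  played equally often would be allowed. So the vertices fall into parts `d v = i`, and all but a small proportion of the copies are transversals in which every
  vertex plays its role `d` (`card_nondominant_le`).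
* By maximality no vertex can gain by changing sides, which bounds every part from below
  (`exchange`, `part_size_four`, `part_size_of_five_le`).
* A copy that is neither transversal nor inside a part contains a vertex `v` playing a role other
  than `d v`, and all its vertices except `v` are among the few exceptional vertices of `v`, one of them
  in another part. Each such exceptional vertex destroys many transversals through `v`. Comparing
  the two effects at each vertex, mixed copies are outnumbered by transversals that are not copies
  (`card_mixed_le_card_bad_of_five_le`, `card_mixed_le_card_bad_of_four`; the case of four roles is
  tight enough to require counting twice the copies with a single vertex out of its role).
* Hence there are at most `∏ i, s i + ∑ i, blowupCount (k - 1) (s i)` copies, where `s i` are the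
  sizes of the parts, and this is at most `blowupCount (k - 1) s` (`sum_blowupCount_add_prod_le`).
-/

set_option linter.unusedSectionVars false

open Finset

/-! ### Balanced products -/

/-- The balanced product: the product of the parts when `n` is split into `m` parts as equal as
possible. The parts are `(n + i) / m` for `i < m`. -/
def balProd (m n : ℕ) : ℕ := ∏ i ∈ range m, (n + i) / m

/-- The parts of a balanced partition of `n` into `m + 1` parts, except the smallest one, are the
parts of a balanced partition of `n - n / (m + 1)` into `m` parts. -/
lemma balanced_part_eq {m i : ℕ} (n : ℕ) (hi : i < m) :
    (n + 1 + i) / (m + 1) = (n - n / (m + 1) + i) / m := by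
  have hm : 0 < m := by omega
  obtain ⟨q, r, hr, rfl⟩ : ∃ q r, r < m + 1 ∧ n = (m + 1) * q + r :=
    ⟨n / (m + 1), n % (m + 1), Nat.mod_lt _ (by omega), (Nat.div_add_mod _ _).symm⟩
  have h1 : ((m + 1) * q + r) / (m + 1) = q := by
    rw [Nat.mul_add_div (by omega), Nat.div_eq_of_lt hr, add_zero]
  have h2 : (m + 1) * q + r - q + i = m * q + (r + i) := by
    have : (m + 1) * q = m * q + q := by ring
    omega
  have h3 : (m + 1) * q + r + 1 + i = (m + 1) * q + (r + 1 + i) := by ring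
  rw [h1, h2, h3, Nat.mul_add_div (by omega), Nat.mul_add_div hm]
  congr 1
  by_cases h : r + i < m
  · rw [Nat.div_eq_of_lt h, Nat.div_eq_of_lt (by omega)]
  · rw [Nat.div_eq_of_lt_le (m := r + i) (k := 1) (by omega) (by omega),
      Nat.div_eq_of_lt_le (k := 1) (by omega) (by omega)]

lemma balProd_succ_succ (m n : ℕ) :
    balProd (m + 1) (n + 1) = balProd (m + 1) n + balProd m (n - n / (m + 1)) := by
  have h1 : balProd (m + 1) (n + 1) = balProd m (n - n / (m + 1)) * (n / (m + 1) + 1) := by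
    unfold balProd
    rw [prod_range_succ]
    congr 1
    · exact prod_congr rfl fun i hi => balanced_part_eq n (mem_range.1 hi)
    · rw [show n + 1 + m = n + (m + 1) by ring, Nat.add_div_right _ (by omega)]
  have h2 : balProd (m + 1) n = balProd m (n - n / (m + 1)) * (n / (m + 1)) := by
    unfold balProd
    rw [prod_range_succ']
    congr 1
    refine prod_congr rfl fun i hi => ?_
    rw [← balanced_part_eq n (mem_range.1 hi)]
    congr 1
    ring
  rw [h1, h2]
  ring

lemma balProd_mono (m : ℕ) : Monotone (balProd m) := fun a b h =>
  prod_le_prod' fun i _ => Nat.div_le_div_right (by omega)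

lemma balProd_eq_zero {m n : ℕ} (h : n < m) : balProd m n = 0 :=
  prod_eq_zero (i := 0) (mem_range.2 (by omega)) (by simpa using Nat.div_eq_of_lt h)

lemma sub_div_mono (m : ℕ) : Monotone fun n : ℕ => n - n / (m + 1) := by
  refine monotone_nat_of_le_succ fun n => ?_
  have h1 : (n + 1) / (m + 1) ≤ n / (m + 1) + 1 := by
    rw [← Nat.add_div_right _ (Nat.succ_pos m)]
    exact Nat.div_le_div_right (by omega)
  change n - n / (m + 1) ≤ n + 1 - (n + 1) / (m + 1)
  omega

/-- The increments of `balProd (m + 1)` form a monotone sequence: `balProd` is convex. -/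
lemma balProd_incr_mono (m : ℕ) : Monotone fun n => balProd m (n - n / (m + 1)) :=
  (balProd_mono m).comp (sub_div_mono m)

lemma sum_balanced_parts (m n : ℕ) : ∑ i ∈ range (m + 1), (n + i) / (m + 1) = n := by
  induction n with
  | zero =>
    refine sum_eq_zero fun i hi => ?_
    rw [zero_add]
    exact Nat.div_eq_of_lt (mem_range.1 hi)
  | succ n ih =>
    rw [sum_range_succ'] at ih
    rw [sum_range_succ, show n + 1 + m = n + (m + 1) by ring, Nat.add_div_right _ (by omega)]
    have : ∑ i ∈ range m, (n + 1 + i) / (m + 1) = ∑ i ∈ range m, (n + (i + 1)) / (m + 1) :=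
      sum_congr rfl fun i _ => by rw [show n + 1 + i = n + (i + 1) by ring]
    rw [this]
    simp only [add_zero] at ih
    omega

/-- The inequality of arithmetic and geometric means, in integers: among the tuples with a given
sum, the balanced ones have the largest product. -/
lemma prod_le_balProd {ι : Type*} [DecidableEq ι] (m : ℕ) :
    ∀ (S : Finset ι), S.card = m → ∀ f : ι → ℕ, ∏ i ∈ S, f i ≤ balProd m (∑ i ∈ S, f i) := by
  induction m with
  | zero =>
    intro S hS f
    rw [card_eq_zero.1 hS]
    simp [balProd]
  | succ m ih =>
    intro S hS f
    obtain ⟨N, hN⟩ : ∃ N, ∑ i ∈ S, f i = N := ⟨_, rfl⟩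
    induction N generalizing f with
    | zero =>
      obtain ⟨i, hi⟩ : S.Nonempty := card_pos.1 (by omega)
      rw [prod_eq_zero hi (sum_eq_zero_iff.1 hN i hi)]
      exact Nat.zero_le _
    | succ N ihN =>
      -- Lower a largest entry by one.
      obtain ⟨i, hi, hmax⟩ := exists_max_image S f (card_pos.1 (by omega))
      have hsum : f i + ∑ j ∈ S.erase i, f j = ∑ j ∈ S, f j := add_sum_erase S f hi
      have hle : N + 1 ≤ (m + 1) * f i := by
        rw [← hN, ← hS, ← smul_eq_mul]
        exact sum_le_card_nsmul _ _ _ hmax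
      have hfi : 0 < f i := by
        by_contra h
        rw [Nat.eq_zero_of_not_pos h] at hle
        omega
      set f' : ι → ℕ := Function.update f i (f i - 1) with hf'
      have he : ∀ j ∈ S.erase i, f' j = f j := fun j hj => by
        rw [hf', Function.update_of_ne (ne_of_mem_erase hj)]
      have hf'i : f' i = f i - 1 := by simp [hf']
      have hs' : ∑ j ∈ S, f' j = N := by
        rw [← add_sum_erase S f' hi, hf'i]
        have : ∑ j ∈ S.erase i, f' j = ∑ j ∈ S.erase i, f j := sum_congr rfl he
        omega
      have h1 := ihN f' hs'
      rw [hs'] at h1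
      rw [← mul_prod_erase S f' hi, prod_congr rfl he, hf'i] at h1
      have h2 := ih (S.erase i) (by rw [card_erase_of_mem hi, hS]; rfl) f
      have h3 : ∑ j ∈ S.erase i, f j ≤ N - N / (m + 1) := by
        have : N / (m + 1) < f i := by
          rw [Nat.div_lt_iff_lt_mul (by omega), mul_comm]
          omega
        omega
      have h4 := h2.trans (balProd_mono m h3)
      rw [hN, balProd_succ_succ, ← mul_prod_erase S f hi]
      calc f i * ∏ j ∈ S.erase i, f j
          = (f i - 1) * ∏ j ∈ S.erase i, f j + ∏ j ∈ S.erase i, f j := by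
            conv_lhs => rw [show f i = f i - 1 + 1 by omega]
            ring
        _ ≤ _ := add_le_add h1 h4

/-- The inequality of arithmetic and geometric means, without denominators. -/
lemma pow_mul_prod_le {ι : Type*} (S : Finset ι) (f : ι → ℕ) :
    S.card ^ S.card * ∏ i ∈ S, f i ≤ (∑ i ∈ S, f i) ^ S.card := by
  rcases S.eq_empty_or_nonempty with rfl | hne
  · simp
  have hc : (0 : ℝ) < S.card := by exact_mod_cast card_pos.2 hne
  have h := Real.geom_mean_le_arith_mean S (fun _ => 1) (fun i => (f i : ℝ))
    (fun _ _ => zero_le_one) (by simpa using hne) (fun _ _ => Nat.cast_nonneg _)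
  simp only [Real.rpow_one, sum_const, nsmul_eq_mul, mul_one, one_mul] at h
  have hp : (0 : ℝ) ≤ ∏ i ∈ S, (f i : ℝ) := prod_nonneg fun _ _ => Nat.cast_nonneg _
  have h1 := pow_le_pow_left₀ (Real.rpow_nonneg hp _) h S.card
  rw [Real.rpow_inv_natCast_pow hp (card_pos.2 hne).ne', div_pow, le_div_iff₀ (by positivity)] at h1
  have h2 : ((S.card ^ S.card * ∏ i ∈ S, f i : ℕ) : ℝ) ≤ ((∑ i ∈ S, f i) ^ S.card : ℕ) := by
    push_cast
    linarith
  exact_mod_cast h2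

lemma pow_mul_balProd_le (m n : ℕ) : m ^ m * balProd m n ≤ n ^ m := by
  cases m with
  | zero => simp [balProd]
  | succ m =>
    have h := pow_mul_prod_le (range (m + 1)) fun i => (n + i) / (m + 1)
    rwa [sum_balanced_parts, card_range] at h

/-! ### Sequences with monotone increments -/

section Convex

variable {p c : ℕ → ℕ} (hp : ∀ n, p (n + 1) = p n + c n) (hc : Monotone c)
include hp hc

lemma convex_shift {a b : ℕ} (d : ℕ) (hab : a ≤ b) : p (a + d) + p b ≤ p (b + d) + p a := by
  induction d with
  | zero => simp only [add_zero]; omega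
  | succ d ih =>
    have := hc (show a + d ≤ b + d by omega)
    rw [← add_assoc, ← add_assoc, hp, hp]
    omega

lemma convex_superadd (h0 : p 0 = 0) (a b : ℕ) : p a + p b ≤ p (a + b) := by
  have := convex_shift hp hc a (Nat.zero_le b)
  rw [h0, zero_add] at this
  rwa [add_comm a b]

/-- Two numbers at most `M` with sum at most `M + E` are majorized by `M` and `E`. -/
lemma convex_two {M E x y : ℕ} (hx : x ≤ M) (hy : y ≤ M) (h : x + y ≤ M + E) :
    p x + p y ≤ p M + p E := by
  have hmono : Monotone p := monotone_nat_of_le_succ fun n => by rw [hp]; omega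
  by_cases hE : y ≤ E
  · exact add_le_add (hmono hx) (hmono hE)
  · obtain ⟨d, rfl⟩ : ∃ d, y = E + d := ⟨y - E, by omega⟩
    by_cases hEx : E ≤ x
    · have := convex_shift hp hc d hEx
      have := hmono (show x + d ≤ M by omega)
      omega
    · have := hmono (show x ≤ E by omega)
      have := hmono hy
      omega

lemma convex_sum_le (h0 : p 0 = 0) {ι : Type*} (T : Finset ι) (x : ι → ℕ) :
    ∑ i ∈ T, p (x i) ≤ p (∑ i ∈ T, x i) := by
  classical
  induction T using Finset.induction_on with
  | empty => simp
  | insert a T ha ih =>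
    rw [sum_insert ha, sum_insert ha]
    exact (Nat.add_le_add_left ih _).trans (convex_superadd hp hc h0 _ _)

/-- Numbers at most `M` with sum at most `M + E` are majorized by `M` and `E`. -/
lemma convex_majorize (h0 : p 0 = 0) {ι : Type*} {M : ℕ} (S : Finset ι) (x : ι → ℕ)
    (hx : ∀ i ∈ S, x i ≤ M) : ∀ E ≤ M, ∑ i ∈ S, x i ≤ M + E → ∑ i ∈ S, p (x i) ≤ p M + p E := by
  classical
  induction S using Finset.induction_on with
  | empty => intro E _ _; simp
  | insert a T ha ih =>
    intro E hE hsum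
    rw [sum_insert ha] at hsum ⊢
    have hxa := hx a (mem_insert_self _ _)
    by_cases hR : ∑ i ∈ T, x i ≤ M
    · exact (Nat.add_le_add_left (convex_sum_le hp hc h0 T x) _).trans
        (convex_two hp hc hxa hR hsum)
    · have hmono : Monotone p := monotone_nat_of_le_succ fun n => by rw [hp]; omega
      have h1 := ih (fun i hi => hx i (mem_insert_of_mem hi)) (∑ i ∈ T, x i - M) (by omega)
        (by omega)
      have h2 := convex_superadd hp hc h0 (x a) (∑ i ∈ T, x i - M)
      have h3 := hmono (show x a + (∑ i ∈ T, x i - M) ≤ E by omega)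
      omega

end Convex

lemma balProd_convex (m : ℕ) (h : 0 < m) : ∃ c : ℕ → ℕ, Monotone c ∧
    ∀ n, balProd m (n + 1) = balProd m n + c n := by
  obtain ⟨m, rfl⟩ : ∃ l, m = l + 1 := ⟨m - 1, by omega⟩
  exact ⟨_, balProd_incr_mono m, balProd_succ_succ m⟩

/-! ### The balanced recursion -/

/-- The number of copies gained by passing from `n` to `n + 1` vertices in a balanced iterated
blow-up with `m + 1` parts: the new vertex enters a smallest part. The value for `m = 0` is
irrelevant and set to `0` for termination. -/
def gain (m n : ℕ) : ℕ :=
  if n = 0 ∨ m = 0 then 0 else gain m (n / (m + 1)) + balProd m (n - n / (m + 1))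
termination_by n
decreasing_by exact Nat.div_lt_self (by omega) (by omega)

/-- The number of copies in a balanced iterated blow-up with `m + 1` parts on `s` vertices. -/
def blowupCount (m s : ℕ) : ℕ := ∑ n ∈ range s, gain m n

lemma gain_eq {m : ℕ} (hm : 0 < m) (n : ℕ) :
    gain m n = gain m (n / (m + 1)) + balProd m (n - n / (m + 1)) := by
  by_cases hn : n = 0
  · subst hn
    have h0 : gain m 0 = 0 := by rw [gain]; simp
    simp [h0, balProd_eq_zero hm]
  · rw [gain, if_neg (by omega)]

lemma blowupCount_succ (m s : ℕ) : blowupCount m (s + 1) = blowupCount m s + gain m s :=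
  sum_range_succ _ _

lemma blowupCount_balanced {m : ℕ} (hm : 0 < m) (s : ℕ) : blowupCount m s =
    ∑ i ∈ range (m + 1), blowupCount m ((s + i) / (m + 1)) + balProd (m + 1) s := by
  induction s with
  | zero =>
    rw [balProd_eq_zero (by omega), add_zero]
    refine (sum_eq_zero fun i hi => ?_).symm
    rw [zero_add, Nat.div_eq_of_lt (mem_range.1 hi)]
    rfl
  | succ s ih =>
    rw [sum_range_succ'] at ih
    rw [blowupCount_succ, ih, sum_range_succ, show s + 1 + m = s + (m + 1) by ring,
      Nat.add_div_right _ (by omega), blowupCount_succ, balProd_succ_succ, gain_eq hm s]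
    have : ∀ i, s + 1 + i = s + (i + 1) := fun i => by ring
    simp only [this, add_zero]
    ring

lemma balProd_le_blowupCount {m : ℕ} (hm : 0 < m) (s : ℕ) :
    balProd (m + 1) s ≤ blowupCount m s := by
  rw [blowupCount_balanced hm s]
  omega

lemma blowupCount_le_erdosHajnalG {m : ℕ} (hm : 0 < m) (s : ℕ) :
    blowupCount m s ≤ erdosHajnalG (m + 1) s := by
  induction s using Nat.strong_induction_on with
  | _ s ih =>
    by_cases hs : s < m + 1
    · have : blowupCount m s = 0 := by
        refine sum_eq_zero fun n hn => ?_
        have hn := mem_range.1 hn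
        rw [gain_eq hm, Nat.div_eq_of_lt (by omega), Nat.sub_zero, balProd_eq_zero (by omega)]
        rw [gain]
        simp
      omega
    · have hlt : ∀ i : Fin (m + 1), (s + i) / (m + 1) < s := fun i => by
        rw [Nat.div_lt_iff_lt_mul (by omega)]
        have := i.isLt
        nlinarith
      rw [erdosHajnalG, if_neg hs, blowupCount_balanced hm s]
      have hmem : (fun i : Fin (m + 1) => (⟨(s + i) / (m + 1), hlt i⟩ : Fin s)) ∈
          univ.filter fun p : Fin (m + 1) → Fin s => ∑ i, (p i : ℕ) = s := by
        rw [mem_filter]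
        refine ⟨mem_univ _, ?_⟩
        change ∑ i : Fin (m + 1), (s + (i : ℕ)) / (m + 1) = s
        rw [Fin.sum_univ_eq_sum_range fun i => (s + i) / (m + 1)]
        exact sum_balanced_parts m s
      refine le_trans ?_ (le_sup (f := fun p : Fin (m + 1) → Fin s =>
        ∑ i, erdosHajnalG (m + 1) (p i) + ∏ i, (p i : ℕ)) hmem)
      refine add_le_add ?_ ?_
      · rw [← Fin.sum_univ_eq_sum_range fun i => blowupCount m ((s + i) / (m + 1))]
        exact sum_le_sum fun i _ => ih _ (hlt i)
      · exact (Fin.prod_univ_eq_prod_range (fun i => (s + i) / (m + 1)) (m + 1)).ge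

/-- The increments of `gain` are bounded by those of `balProd`. -/
lemma gain_succ_le {m : ℕ} {c : ℕ → ℕ} (hm : 0 < m) (hcm : Monotone c)
    (hc : ∀ n, balProd m (n + 1) = balProd m n + c n) (μ : ℕ) :
    gain m (μ + 1) ≤ gain m μ + c (μ - (μ + 1) / (m + 1)) := by
  induction μ using Nat.strong_induction_on with
  | _ μ ih =>
    rw [gain_eq hm (μ + 1), gain_eq hm μ]
    have hle : (μ + 1) / (m + 1) ≤ μ := by
      rw [← Nat.lt_succ_iff, Nat.div_lt_iff_lt_mul (by omega)]
      nlinarith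
    rw [show μ + 1 - (μ + 1) / (m + 1) = μ - (μ + 1) / (m + 1) + 1 by omega, hc]
    by_cases hd : m + 1 ∣ μ + 1
    · obtain ⟨j, hj⟩ := hd
      obtain ⟨j, rfl⟩ : ∃ l, j = l + 1 := ⟨j - 1, by
        rcases j with _ | j
        · omega
        · omega⟩
      have hμ : μ = (m + 1) * j + m := by
        have : (m + 1) * (j + 1) = (m + 1) * j + m + 1 := by ring
        omega
      have h1 : (μ + 1) / (m + 1) = j + 1 := by rw [hj, Nat.mul_div_cancel_left _ (by omega)]
      have h2 : μ / (m + 1) = j := by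
        rw [hμ, Nat.mul_add_div (by omega), Nat.div_eq_of_lt (by omega), add_zero]
      have h3 : j + (j + 1) ≤ μ := by rw [hμ]; nlinarith
      rw [h1, h2, show μ - j = μ - (j + 1) + 1 by omega, hc]
      have := ih j (by omega)
      have := hcm (show j - (j + 1) / (m + 1) ≤ μ - (j + 1) from (Nat.sub_le _ _).trans (by omega))
      omega
    · rw [Nat.succ_div_of_not_dvd hd]
      omega

/-- The number of copies gained by adding a vertex to a part of size `μ`, where the other `n - μ`
vertices are split evenly: it is largest when the part of size `μ` is a smallest one. -/
lemma gain_add_balProd_le {m n : ℕ} (hm : 0 < m) (μ : ℕ) (h1 : n / (m + 1) ≤ μ)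
    (h2 : 2 * μ ≤ n + 1) (h3 : μ ≤ n) : gain m μ + balProd m (n - μ) ≤ gain m n := by
  obtain ⟨c, hcm, hc⟩ := balProd_convex m hm
  induction μ, h1 using Nat.le_induction with
  | base => exact (gain_eq hm n).ge
  | succ μ hμ ih =>
    have h4 := ih (by omega) (by omega)
    have h5 := gain_succ_le hm hcm hc μ
    have h6 := hcm (show μ - (μ + 1) / (m + 1) ≤ n - (μ + 1) from (Nat.sub_le _ _).trans (by omega))
    rw [show n - μ = n - (μ + 1) + 1 by omega, hc] at h4
    omega

/-- If no part is much larger than half of the vertices, then an iterated blow-up that splits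
the vertices as prescribed, and is balanced from the second level on, has no more copies
than the balanced one. -/
lemma sum_blowupCount_add_prod_le {ι : Type*} [Fintype ι] {m : ℕ} (hm : 0 < m)
    (hι : Fintype.card ι = m + 1) (s : ℕ) : ∀ f : ι → ℕ, ∑ i, f i = s →
    (∀ i, 2 * f i ≤ s + 2) → ∑ i, blowupCount m (f i) + ∏ i, f i ≤ blowupCount m s := by
  classical
  have hne : (univ : Finset ι).Nonempty := by
    rw [← card_pos, card_univ]
    omega
  induction s with
  | zero =>
    intro f hf _
    have h0 : ∀ i, f i = 0 := fun i => sum_eq_zero_iff.1 hf i (mem_univ i)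
    obtain ⟨i, hi⟩ := hne
    rw [prod_eq_zero hi (h0 i), add_zero]
    refine (sum_eq_zero fun i _ => ?_).le.trans (Nat.zero_le _)
    rw [h0]
    rfl
  | succ s ih =>
    intro f hf hhalf
    obtain ⟨i, hi, hmax⟩ := exists_max_image univ f hne
    have hsum : f i + ∑ j ∈ univ.erase i, f j = ∑ j, f j := add_sum_erase univ f hi
    have hle : s + 1 ≤ (m + 1) * f i := by
      rw [← hf, ← hι, ← smul_eq_mul, ← card_univ]
      exact sum_le_card_nsmul _ _ _ hmax
    have hfi : 0 < f i := by
      by_contra h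
      rw [Nat.eq_zero_of_not_pos h] at hle
      omega
    set f' : ι → ℕ := Function.update f i (f i - 1) with hf'
    have he : ∀ j ∈ univ.erase i, f' j = f j := fun j hj => by
      rw [hf', Function.update_of_ne (ne_of_mem_erase hj)]
    have hf'i : f' i = f i - 1 := by simp [hf']
    have hs' : ∑ j, f' j = s := by
      rw [← add_sum_erase univ f' hi, hf'i]
      have : ∑ j ∈ univ.erase i, f' j = ∑ j ∈ univ.erase i, f j := sum_congr rfl he
      omega
    have h1 := ih f' hs' fun j => by
      by_cases hj : j = i
      · rw [hj, hf'i]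
        have := hhalf i
        omega
      · rw [he j (mem_erase.2 ⟨hj, mem_univ _⟩)]
        have := hmax j (mem_univ j)
        have := single_le_sum (f := f) (fun _ _ => Nat.zero_le _)
          (mem_erase.2 ⟨hj, mem_univ j⟩)
        omega
    have h2 := prod_le_balProd m (univ.erase i)
      (by rw [card_erase_of_mem hi, card_univ, hι]; rfl) f
    have h7 : ∑ j ∈ univ.erase i, f j = s - (f i - 1) := by omega
    rw [h7] at h2
    have hhi := hhalf i
    have h3 := gain_add_balProd_le hm (n := s) (f i - 1)
      (by
        rw [← Nat.lt_succ_iff, Nat.div_lt_iff_lt_mul (by omega), mul_comm]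
        have : Nat.succ (f i - 1) = f i := by omega
        rw [this]
        omega) (by omega) (by omega)
    have h4 : blowupCount m (f i) = blowupCount m (f i - 1) + gain m (f i - 1) := by
      rw [← blowupCount_succ]
      congr 1
      omega
    have h5 : ∑ j ∈ univ.erase i, blowupCount m (f' j) = ∑ j ∈ univ.erase i, blowupCount m (f j) :=
      sum_congr rfl fun j hj => by rw [he j hj]
    have h6 : f i * ∏ j ∈ univ.erase i, f j
        = (f i - 1) * ∏ j ∈ univ.erase i, f j + ∏ j ∈ univ.erase i, f j := by
      conv_lhs => rw [show f i = f i - 1 + 1 by omega]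
      ring
    rw [← add_sum_erase univ (fun j => blowupCount m (f' j)) hi,
      ← mul_prod_erase univ f' hi, prod_congr rfl he, hf'i, h5] at h1
    change _ + (f i - 1) * ∏ j ∈ univ.erase i, f j ≤ _ at h1
    rw [← add_sum_erase univ (fun j => blowupCount m (f j)) hi, ← mul_prod_erase univ f hi,
      blowupCount_succ, h4]
    change _ + f i * ∏ j ∈ univ.erase i, f j ≤ _
    omega

/-! ### Numerical estimates -/

lemma pow_le_balProd_incr {m f x : ℕ} (h : (m + 1) * f ≤ x + 1) :
    f ^ m ≤ balProd m (x - x / (m + 1)) := by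
  unfold balProd
  rw [← card_range m, ← prod_const, card_range]
  refine prod_le_prod' fun i hi => ?_
  rw [← balanced_part_eq x (mem_range.1 hi), Nat.le_div_iff_mul_le (by omega)]
  nlinarith

/-- A sufficient condition for `balProd (m + 1) (n - (q + h)) + balProd (m + 1) (q + h)`
not to exceed `balProd (m + 1) (n - q)`. -/
lemma balProd_add_le_of_pow_le {m n q h f : ℕ} (hq : (m + 2) * q ≤ n) (hh : q + h ≤ n)
    (hf : (m + 1) * f + h ≤ (m + 1) * q + 1)
    (hpow : (q + h) ^ (m + 1) ≤ (m + 1) ^ (m + 1) * (h * f ^ m)) :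
    balProd (m + 1) (n - (q + h)) + balProd (m + 1) (q + h) ≤ balProd (m + 1) (n - q) := by
  have h1 : balProd (m + 1) (q + h) ≤ h * f ^ m :=
    Nat.le_of_mul_le_mul_left ((pow_mul_balProd_le (m + 1) (q + h)).trans hpow) (by positivity)
  have h2 : ∀ d, balProd (m + 1) (n - (q + h)) + d * f ^ m
      ≤ balProd (m + 1) (n - (q + h) + d) := by
    intro d
    induction d with
    | zero => simp
    | succ d ih =>
      rw [← add_assoc, balProd_succ_succ, add_mul, one_mul, ← add_assoc]
      refine add_le_add ih (pow_le_balProd_incr ?_)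
      have : (m + 2) * q = (m + 1) * q + q := by ring
      omega
  have h3 := h2 h
  rw [show n - (q + h) + h = n - q by omega] at h3
  omega

/-- The hypothesis `hpow` of `balProd_add_le_of_pow_le` for `m = 2`, with `h = q / 20 + 1`. -/
lemma cube_estimate (q : ℕ) (hq : 3 ≤ q) :
    (q + (q / 20 + 1)) ^ 3 ≤ 27 * ((q / 20 + 1) * (q - (q / 20 + 2) / 3) ^ 2) := by
  obtain ⟨t, u, hu, rfl⟩ : ∃ t u, u < 20 ∧ q = 20 * t + u :=
    ⟨q / 20, q % 20, Nat.mod_lt _ (by omega), by omega⟩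
  rw [show (20 * t + u) / 20 = t by omega]
  obtain ⟨f, hf⟩ : ∃ f, f = 20 * t + u - (t + 2) / 3 := ⟨_, rfl⟩
  rw [← hf]
  rcases Nat.eq_zero_or_pos t with rfl | ht
  · rw [show f = 20 * 0 + u by omega]
    have hu3 : 3 ≤ u := by omega
    interval_cases u <;> norm_num
  · have h3 : 59 * t + 3 * u ≤ 3 * f + 2 := by omega
    have key : ∀ a b : ℕ, a * (20 * t + u + (t + 1)) ≤ b * (3 * f) →
        b ^ 2 * (20 * t + u + (t + 1)) ≤ 3 * a ^ 2 * (t + 1) → 0 < b →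
        (20 * t + u + (t + 1)) ^ 3 ≤ 27 * ((t + 1) * f ^ 2) := by
      intro a b h1 h2 hb
      have h4 := Nat.pow_le_pow_left h1 2
      have h5 : b ^ 2 * (20 * t + u + (t + 1)) ^ 3 ≤ b ^ 2 * (27 * ((t + 1) * f ^ 2)) := by
        calc b ^ 2 * (20 * t + u + (t + 1)) ^ 3
            = b ^ 2 * (20 * t + u + (t + 1)) * (20 * t + u + (t + 1)) ^ 2 := by ring
          _ ≤ 3 * a ^ 2 * (t + 1) * (20 * t + u + (t + 1)) ^ 2 := Nat.mul_le_mul_right _ h2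
          _ = 3 * (t + 1) * (a * (20 * t + u + (t + 1))) ^ 2 := by ring
          _ ≤ 3 * (t + 1) * (b * (3 * f)) ^ 2 := Nat.mul_le_mul_left _ h4
          _ = b ^ 2 * (27 * ((t + 1) * f ^ 2)) := by ring
      exact Nat.le_of_mul_le_mul_left h5 (by positivity)
    by_cases hc : 47 ≤ 23 * t + 3 * u
    · exact key 27 10 (by omega) (by omega) (by omega)
    · exact key 5 2 (by omega) (by omega) (by omega)

lemma pow_estimate (q m : ℕ) (hq : 3 ≤ q) :
    (q + (q / 20 + 1)) ^ (m + 3) ≤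
      (m + 3) ^ (m + 3) * ((q / 20 + 1) * (q - (q / 20 + 2) / 3) ^ (m + 2)) := by
  induction m with
  | zero => simpa using cube_estimate q hq
  | succ m ih =>
    obtain ⟨f, hf⟩ : ∃ f, f = q - (q / 20 + 2) / 3 := ⟨_, rfl⟩
    rw [← hf] at ih ⊢
    have h1 : q + (q / 20 + 1) ≤ (m + 4) * f := by
      have : 4 * f ≤ (m + 4) * f := Nat.mul_le_mul_right _ (by omega)
      omega
    calc (q + (q / 20 + 1)) ^ (m + 1 + 3)
        = (q + (q / 20 + 1)) ^ (m + 3) * (q + (q / 20 + 1)) := by ring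
      _ ≤ (m + 3) ^ (m + 3) * ((q / 20 + 1) * f ^ (m + 2)) * ((m + 4) * f) :=
          Nat.mul_le_mul ih h1
      _ ≤ (m + 4) ^ (m + 3) * ((q / 20 + 1) * f ^ (m + 2)) * ((m + 4) * f) := by
          gcongr
          omega
      _ = _ := by ring

/-- With `E = n / (m + 1) + 1`, a vertex with at least `E` exceptional vertices is in too few
copies. This value of `E` works as long as `n / (m + 1) < m`, and then `E ≤ m`. -/
lemma balProd_split_le_of_small {m n : ℕ} (hm : 3 ≤ m) (hn : m ≤ n) (hq : n / (m + 1) < m) :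
    2 * (n / (m + 1) + 1) ≤ n ∧
    balProd m (n - (n / (m + 1) + 1)) + balProd m (n / (m + 1) + 1)
      ≤ balProd m (n - n / (m + 1)) := by
  have hqn := Nat.div_mul_le_self n (m + 1)
  obtain ⟨q, hqe⟩ : ∃ q, q = n / (m + 1) := ⟨_, rfl⟩
  rw [← hqe] at hq hqn ⊢
  rcases Nat.eq_zero_or_pos q with rfl | hpos
  · refine ⟨by omega, ?_⟩
    rw [balProd_eq_zero (n := 0 + 1) (by omega), add_zero]
    exact balProd_mono m (by omega)
  have h2 : 2 * (q + 1) ≤ n := by nlinarith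
  refine ⟨h2, ?_⟩
  obtain ⟨l, rfl⟩ : ∃ l, m = l + 1 := ⟨m - 1, by omega⟩
  refine balProd_add_le_of_pow_le (f := q) (by linarith) (by omega) le_rfl ?_
  calc (q + 1) ^ (l + 1) ≤ (l + 1) ^ (l + 1) * 1 := by
        rw [mul_one]
        exact Nat.pow_le_pow_left (by omega) _
    _ ≤ _ := Nat.mul_le_mul_left _ (by rw [one_mul]; exact Nat.one_le_pow _ _ hpos)

/-- The analogue of `balProd_split_le_of_small` for large `n`, where `E` has to exceed `n / (m + 1)`
by a small proportion. One twentieth leaves enough room below, for four parts. -/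
lemma balProd_split_le {m n : ℕ} (hm : 3 ≤ m) (hq : m ≤ n / (m + 1)) :
    2 * (n / (m + 1) + (n / (m + 1) / 20 + 1)) ≤ n ∧
    balProd m (n - (n / (m + 1) + (n / (m + 1) / 20 + 1))) +
        balProd m (n / (m + 1) + (n / (m + 1) / 20 + 1))
      ≤ balProd m (n - n / (m + 1)) := by
  have hqn := Nat.div_mul_le_self n (m + 1)
  obtain ⟨q, hqe⟩ : ∃ q, q = n / (m + 1) := ⟨_, rfl⟩
  rw [← hqe] at hq hqn ⊢
  have h4 : q * 4 ≤ q * (m + 1) := Nat.mul_le_mul_left _ (by omega)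
  refine ⟨by omega, ?_⟩
  obtain ⟨l, rfl⟩ : ∃ l, m = l + 3 := ⟨m - 3, by omega⟩
  refine balProd_add_le_of_pow_le (m := l + 2) (f := q - (q / 20 + 2) / 3) (by linarith)
    (by omega) ?_ (pow_estimate q l (by omega))
  obtain ⟨w, hw⟩ : ∃ w, w = (q / 20 + 2) / 3 := ⟨_, rfl⟩
  rw [← hw]
  have h5 : (l + 2 + 1) * q = (l + 2 + 1) * (q - w) + (l + 2 + 1) * w := by
    rw [← mul_add]
    congr 1
    omega
  have h6 : 3 * w ≤ (l + 2 + 1) * w := Nat.mul_le_mul_right _ (by omega)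
  omega

/-- A lower bound for `balProd (m + 1) s`: one part is at least `s / (m + 1)`, and all parts are at
least `q`. -/
lemma mul_pow_le_balProd (m s q : ℕ) (h : q ≤ s / (m + 1)) :
    s * q ^ m ≤ (m + 1) * balProd (m + 1) s := by
  unfold balProd
  rw [prod_range_succ, mul_left_comm, mul_comm s]
  refine Nat.mul_le_mul ?_ ?_
  · rw [← card_range m, ← prod_const, card_range]
    exact prod_le_prod' fun i _ => h.trans (Nat.div_le_div_right (by omega))
  · have := Nat.div_add_mod (s + m) (m + 1)
    have := Nat.mod_lt (s + m) (show m + 1 > 0 by omega)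
    omega

lemma pow_lower_estimate (m : ℕ) (hm : 4 ≤ m) : 40 * (m + 1) * 21 ^ m ≤ (20 * m) ^ m := by
  induction m, hm using Nat.le_induction with
  | base => norm_num
  | succ m hm ih =>
    calc 40 * (m + 1 + 1) * 21 ^ (m + 1) = 40 * (m + 1) * 21 ^ m * 21 + 40 * 21 ^ (m + 1) := by ring
      _ ≤ 40 * (m + 1) * 21 ^ m * 21 + 40 * (m + 1) * 21 ^ m * 21 := by
          rw [pow_succ]
          nlinarith [Nat.zero_le (m * 21 ^ m)]
      _ = 40 * (m + 1) * 21 ^ m * 42 := by ring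
      _ ≤ (20 * m) ^ m * (20 * (m + 1)) := Nat.mul_le_mul ih (by omega)
      _ ≤ (20 * (m + 1)) ^ m * (20 * (m + 1)) := by gcongr; omega
      _ = _ := by ring

/-- If the copies are almost all among `T` transversal ones, then a part size `x` satisfying
the exchange inequality `hx` is large. For small `q` it matters that `x` is an integer. -/
lemma part_size_four {n N T x q : ℕ} (hq : q = n / 4) (hq3 : 3 ≤ q)
    (hN : balProd 4 (n + 1) ≤ N) (hT : N ≤ T + (n + 1) * balProd 3 (q + q / 20))
    (hx : T * (n - 2) ≤ x * (4 * N)) : 3 * (q + q / 20) ≤ 4 * x := by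
  have h1 := mul_pow_le_balProd 3 (n + 1) q (by omega)
  have h2 := pow_mul_balProd_le 3 (q + q / 20)
  have hNpos : 0 < N := by
    by_contra h
    have h0 : 0 < (n + 1) * q ^ 3 := by positivity
    have h00 : balProd (3 + 1) (n + 1) = 0 := by
      change balProd 4 (n + 1) = 0
      omega
    rw [h00] at h1
    omega
  have hn : 4 * q ≤ n := by omega
  norm_num at h1 h2
  obtain ⟨P, hP⟩ : ∃ P, P = balProd 3 (q + q / 20) := ⟨_, rfl⟩
  rw [← hP] at h2 hT
  by_cases hq20 : q < 20
  · have h0 : q / 20 = 0 := by omega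
    rw [h0, add_zero] at h2 ⊢
    have h3 : 27 * ((n + 1) * P) ≤ 4 * N := by nlinarith
    have h4 : 23 * N ≤ 27 * T := by omega
    have h5 : 23 * (n - 2) * N ≤ 27 * (x * 4) * N := by
      calc 23 * (n - 2) * N = 23 * N * (n - 2) := by ring
        _ ≤ 27 * T * (n - 2) := Nat.mul_le_mul_right _ h4
        _ = 27 * (T * (n - 2)) := by ring
        _ ≤ 27 * (x * (4 * N)) := Nat.mul_le_mul_left _ hx
        _ = _ := by ring
    have h6 := Nat.le_of_mul_le_mul_right h5 hNpos
    omega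
  · have h3 : 20 * (q + q / 20) ≤ 21 * q := by omega
    have h3' := Nat.pow_le_pow_left h3 3
    have h4 : 40 * ((n + 1) * P) ≤ 7 * N := by
      have h7 : 216000 * P ≤ 9261 * q ^ 3 := by
        have e1 : (20 * (q + q / 20)) ^ 3 = 8000 * (q + q / 20) ^ 3 := by ring
        have e2 : (21 * q) ^ 3 = 9261 * q ^ 3 := by ring
        omega
      nlinarith
    have h5 : 33 * N ≤ 40 * T := by omega
    have h6 : 33 * (n - 2) * N ≤ 40 * (x * 4) * N := by
      calc 33 * (n - 2) * N = 33 * N * (n - 2) := by ring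
        _ ≤ 40 * T * (n - 2) := Nat.mul_le_mul_right _ h5
        _ = 40 * (T * (n - 2)) := by ring
        _ ≤ 40 * (x * (4 * N)) := Nat.mul_le_mul_left _ hx
        _ = _ := by ring
    have h7 := Nat.le_of_mul_le_mul_right h6 hNpos
    omega

lemma part_size_of_five_le {m n N T x q : ℕ} (hm : 4 ≤ m) (hq : q = n / (m + 1)) (hq3 : m ≤ q)
    (hN : balProd (m + 1) (n + 1) ≤ N) (hT : N ≤ T + (n + 1) * balProd m (q + q / 20))
    (hx : T * (n + 1 - m) ≤ x * ((m + 1) * N)) : 4 * (q + q / 20) ≤ 5 * x := by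
  have hqn : q * (m + 1) ≤ n := hq ▸ Nat.div_mul_le_self n (m + 1)
  have h1 := mul_pow_le_balProd m (n + 1) q (hq ▸ Nat.div_le_div_right (by omega))
  have h2 := pow_mul_balProd_le m (q + q / 20)
  have hNpos : 0 < N := by
    by_contra h
    have h0 : 0 < (n + 1) * q ^ m := Nat.mul_pos (by omega) (Nat.pow_pos (by omega))
    have : N = 0 := by omega
    rw [this] at hN
    rw [Nat.le_zero.1 hN] at h1
    omega
  obtain ⟨P, hP⟩ : ∃ P, P = balProd m (q + q / 20) := ⟨_, rfl⟩
  rw [← hP] at h2 hT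
  have h3 : 20 * (q + q / 20) ≤ 21 * q := by omega
  have h3' := Nat.pow_le_pow_left h3 m
  have h4 : 40 * ((n + 1) * P) ≤ N := by
    have h5 : 40 * (m + 1) * 21 ^ m * P ≤ 21 ^ m * q ^ m := by
      calc 40 * (m + 1) * 21 ^ m * P ≤ (20 * m) ^ m * P :=
            Nat.mul_le_mul_right _ (pow_lower_estimate m hm)
        _ = 20 ^ m * (m ^ m * P) := by rw [mul_pow]; ring
        _ ≤ 20 ^ m * (q + q / 20) ^ m := Nat.mul_le_mul_left _ h2
        _ = (20 * (q + q / 20)) ^ m := by rw [mul_pow]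
        _ ≤ _ := by rwa [mul_pow 21 q] at h3'
    have h6 : (m + 1) * (40 * P) ≤ q ^ m := by
      refine Nat.le_of_mul_le_mul_left (c := 21 ^ m) ?_ (by positivity)
      linarith
    refine Nat.le_of_mul_le_mul_left (c := m + 1) ?_ (by omega)
    calc (m + 1) * (40 * ((n + 1) * P)) = (n + 1) * ((m + 1) * (40 * P)) := by ring
      _ ≤ (n + 1) * q ^ m := Nat.mul_le_mul_left _ h6
      _ ≤ _ := h1.trans (Nat.mul_le_mul_left _ hN)
  have h5 : 39 * N ≤ 40 * T := by omega
  have h6 : 39 * (n + 1 - m) * N ≤ 40 * (x * (m + 1)) * N := by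
    calc 39 * (n + 1 - m) * N = 39 * N * (n + 1 - m) := by ring
      _ ≤ 40 * T * (n + 1 - m) := Nat.mul_le_mul_right _ h5
      _ = 40 * (T * (n + 1 - m)) := by ring
      _ ≤ 40 * (x * ((m + 1) * N)) := Nat.mul_le_mul_left _ hx
      _ = _ := by ring
  have h7 := Nat.le_of_mul_le_mul_right h6 hNpos
  by_contra hcon
  have h8 : 5 * x + 1 ≤ 4 * (q + q / 20) := by omega
  have h9 : 39 * (q * (m + 1) + 1) ≤ 40 * (x * (m + 1)) + 39 * m := by omega
  have h10 : (5 * x + 1) * (m + 1) ≤ 4 * (q + q / 20) * (m + 1) := Nat.mul_le_mul_right _ h8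
  by_cases hq20 : q < 20
  · have h0 : q / 20 = 0 := by omega
    rw [h0, add_zero] at h10
    have h11 : 7 * (q * (m + 1)) + 47 ≤ 31 * m := by nlinarith
    nlinarith
  · have h11 : 5 * (4 * (q + q / 20) * (m + 1)) ≤ 21 * (q * (m + 1)) := by nlinarith
    have h12 : 27 * (q * (m + 1)) + 200 ≤ 155 * (m + 1) + 200 := by nlinarith
    nlinarith

/-! ### Transversals destroyed by misplaced vertices -/

lemma one_add_sum_mul_prod_one_sub_le {ι : Type*} (S : Finset ι) (x : ι → ℝ)
    (h0 : ∀ i ∈ S, 0 ≤ x i) (h1 : ∀ i ∈ S, x i ≤ 1) :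
    (1 + ∑ i ∈ S, x i) * ∏ i ∈ S, (1 - x i) ≤ 1 := by
  classical
  induction S using Finset.induction_on with
  | empty => simp
  | insert a S ha ih =>
    rw [sum_insert ha, prod_insert ha]
    have ih := ih (fun i hi => h0 i (mem_insert_of_mem hi)) fun i hi => h1 i (mem_insert_of_mem hi)
    have ha0 := h0 a (mem_insert_self _ _)
    have ha1 := h1 a (mem_insert_self _ _)
    have hS : 0 ≤ ∑ i ∈ S, x i := sum_nonneg fun i hi => h0 i (mem_insert_of_mem hi)
    have hP : 0 ≤ ∏ i ∈ S, (1 - x i) :=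
      prod_nonneg fun i hi => by linarith [h1 i (mem_insert_of_mem hi)]
    have h2 : (1 + (x a + ∑ i ∈ S, x i)) * (1 - x a) ≤ 1 + ∑ i ∈ S, x i := by nlinarith
    calc (1 + (x a + ∑ i ∈ S, x i)) * ((1 - x a) * ∏ i ∈ S, (1 - x i))
        = (1 + (x a + ∑ i ∈ S, x i)) * (1 - x a) * ∏ i ∈ S, (1 - x i) := by ring
      _ ≤ (1 + ∑ i ∈ S, x i) * ∏ i ∈ S, (1 - x i) := mul_le_mul_of_nonneg_right h2 hP
      _ ≤ 1 := ih

/-- In a complete multipartite structure with parts of sizes `s i ≥ σ > 0`, removing `z i` elements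
of the part `i` destroys at least `Z σ ^ (#S) / (σ + Z)` transversals, where `Z = ∑ i, z i`. -/
lemma mul_pow_le_prod_sub_prod {ι : Type*} (S : Finset ι) (s z : ι → ℝ) {σ : ℝ} (hσ : 0 < σ)
    (hs : ∀ i ∈ S, σ ≤ s i) (hz : ∀ i ∈ S, 0 ≤ z i) (hzs : ∀ i ∈ S, z i ≤ s i) :
    (∑ i ∈ S, z i) * σ ^ S.card ≤
      (σ + ∑ i ∈ S, z i) * (∏ i ∈ S, s i - ∏ i ∈ S, (s i - z i)) := by
  classical
  have hpos : ∀ i ∈ S, 0 < s i := fun i hi => hσ.trans_le (hs i hi)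
  set X := ∑ i ∈ S, z i / s i with hX
  set Z := ∑ i ∈ S, z i with hZ
  set A := ∏ i ∈ S, s i with hA
  have hA0 : 0 < A := prod_pos hpos
  have hZ0 : 0 ≤ Z := sum_nonneg hz
  have hX0 : 0 ≤ X := sum_nonneg fun i hi => div_nonneg (hz i hi) (hpos i hi).le
  have h1 : (1 + X) * ∏ i ∈ S, (1 - z i / s i) ≤ 1 :=
    one_add_sum_mul_prod_one_sub_le S _ (fun i hi => div_nonneg (hz i hi) (hpos i hi).le)
      fun i hi => (div_le_one (hpos i hi)).2 (hzs i hi)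
  have h2 : ∏ i ∈ S, (s i - z i) = A * ∏ i ∈ S, (1 - z i / s i) := by
    rw [hA, ← prod_mul_distrib]
    refine prod_congr rfl fun i hi => ?_
    have := (hpos i hi).ne'
    field_simp
  have h3 : A * X ≤ (1 + X) * (A - ∏ i ∈ S, (s i - z i)) := by
    rw [h2]
    nlinarith
  have h4 : σ * X ≤ Z := by
    rw [hX, mul_sum]
    refine sum_le_sum fun i hi => ?_
    rw [mul_div_assoc', div_le_iff₀ (hpos i hi)]
    nlinarith [hz i hi, hs i hi]
  have h5 : Z * σ ^ S.card ≤ σ * (A * X) := by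
    rw [hX, hZ, sum_mul, mul_sum, mul_sum]
    refine sum_le_sum fun i hi => ?_
    have h6 : σ ^ (S.erase i).card ≤ ∏ j ∈ S.erase i, s j := by
      rw [← prod_const]
      exact prod_le_prod (fun _ _ => hσ.le) fun j hj => hs j (mem_of_mem_erase hj)
    have h7 : A = s i * ∏ j ∈ S.erase i, s j := (mul_prod_erase S s hi).symm
    have h8 : S.card = (S.erase i).card + 1 := (card_erase_add_one hi).symm
    have h9 : A * (z i / s i) = z i * ∏ j ∈ S.erase i, s j := by
      have := (hpos i hi).ne'
      rw [h7]
      field_simp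
    rw [h9, h8, pow_succ]
    nlinarith [mul_le_mul_of_nonneg_left h6 (mul_nonneg hσ.le (hz i hi))]
  have h10 : 0 ≤ A - ∏ i ∈ S, (s i - z i) := by
    by_contra hcon
    nlinarith
  nlinarith

lemma pow_upper_estimate (m : ℕ) (hm : 3 ≤ m) :
    9 * (m + 2) * 5 ^ m ≤ 4 * (4 * m) ^ m := by
  induction m, hm using Nat.le_induction with
  | base => norm_num
  | succ m hm ih =>
    calc 9 * (m + 1 + 2) * 5 ^ (m + 1) = 45 * (m + 3) * 5 ^ m := by ring
      _ ≤ 9 * (m + 2) * 5 ^ m * 16 := by nlinarith [Nat.zero_le (m * 5 ^ m), Nat.zero_le (5 ^ m)]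
      _ ≤ 4 * (4 * m) ^ m * 16 := Nat.mul_le_mul_right _ ih
      _ ≤ 4 * (4 * (m + 1)) ^ m * (4 * (m + 1)) := by gcongr <;> omega
      _ = _ := by ring

/-- At least five parts: the destroyed transversals `t` at a vertex outnumber `#S + 1` times the
mixed copies `M`. -/
lemma mul_le_destroyed_of_five_le {ι : Type*} (S : Finset ι) (s z : ι → ℕ) {e M t : ℕ}
    (hS : 4 ≤ S.card) (he : 0 < e) (hs : ∀ i ∈ S, 4 * e ≤ 5 * s i) (hzs : ∀ i ∈ S, z i ≤ s i)
    (hze : ∑ i ∈ S, z i ≤ e) (ht : ∏ i ∈ S, s i = t + ∏ i ∈ S, (s i - z i))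
    (hM : (S.card - 1) ^ (S.card - 1) * M ≤ (∑ i ∈ S, z i) * e ^ (S.card - 1)) :
    (S.card + 1) * M ≤ t := by
  have he' : (0 : ℝ) < e := by exact_mod_cast he
  have h1 := mul_pow_le_prod_sub_prod S (fun i => (s i : ℝ)) (fun i => (z i : ℝ))
    (σ := 4 * e / 5) (by positivity)
    (fun i hi => by
      have : (4 * e : ℝ) ≤ 5 * s i := by exact_mod_cast hs i hi
      linarith) (fun i _ => Nat.cast_nonneg _) (fun i hi => by exact_mod_cast hzs i hi)
  have h2 : ∏ i ∈ S, (s i : ℝ) - ∏ i ∈ S, ((s i : ℝ) - z i) = t := by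
    have h3 : ∏ i ∈ S, ((s i : ℝ) - z i) = ((∏ i ∈ S, (s i - z i) : ℕ) : ℝ) := by
      push_cast
      exact prod_congr rfl fun i hi => (Nat.cast_sub (hzs i hi)).symm
    rw [h3, ← Nat.cast_prod, ht]
    push_cast
    ring
  obtain ⟨l, hl⟩ : ∃ l, S.card = l + 1 := ⟨S.card - 1, by omega⟩
  rw [h2, hl] at h1
  rw [hl] at hM ⊢
  simp only [Nat.add_sub_cancel] at hM
  obtain ⟨Z, hZ⟩ : ∃ Z, Z = ∑ i ∈ S, z i := ⟨_, rfl⟩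
  have hZc : (∑ i ∈ S, (z i : ℝ)) = Z := by rw [hZ]; push_cast; rfl
  rw [← hZ] at hM hze
  rw [hZc] at h1
  have hZe : (Z : ℝ) ≤ e := by exact_mod_cast hze
  -- Compare both sides after multiplication by `9 * 5 ^ l * l ^ l`.
  have h4 : 4 * (Z * (4 * e / 5 : ℝ) ^ l) ≤ 9 * t := by
    have h5 : (4 * e / 5 + Z : ℝ) * t ≤ (9 * e / 5) * t :=
      mul_le_mul_of_nonneg_right (by linarith) (Nat.cast_nonneg _)
    have h6 : e * (4 * (Z * (4 * e / 5 : ℝ) ^ l)) ≤ e * (9 * t) := by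
      rw [pow_succ] at h1
      linarith
    exact le_of_mul_le_mul_left h6 he'
  have h7 : 4 * (Z * (4 * e) ^ l) ≤ 9 * 5 ^ l * t := by
    rw [div_pow] at h4
    have h8 : (4 * (Z * (4 * e) ^ l) : ℝ) ≤ 9 * 5 ^ l * t := by
      have := mul_le_mul_of_nonneg_left h4 (show (0 : ℝ) ≤ 5 ^ l by positivity)
      calc (4 * (Z * (4 * e) ^ l) : ℝ) = 5 ^ l * (4 * (Z * ((4 * e) ^ l / 5 ^ l))) := by
            field_simp
        _ ≤ _ := this
        _ = _ := by ring
    exact_mod_cast h8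
  refine Nat.le_of_mul_le_mul_left (c := 9 * 5 ^ l * l ^ l) ?_
    (Nat.mul_pos (by positivity) (Nat.pow_pos (by omega)))
  calc 9 * 5 ^ l * l ^ l * ((l + 1 + 1) * M) = 9 * (l + 2) * 5 ^ l * (l ^ l * M) := by ring
    _ ≤ 4 * (4 * l) ^ l * (Z * e ^ l) := Nat.mul_le_mul (pow_upper_estimate l (by omega)) hM
    _ = l ^ l * (4 * (Z * (4 * e) ^ l)) := by rw [mul_pow, mul_pow]; ring
    _ ≤ l ^ l * (9 * 5 ^ l * t) := Nat.mul_le_mul_left _ h7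
    _ = _ := by ring

/-- Removing `z₁ + z₂ + z₃` elements from three parts of sizes at least `σ` destroys at least as
many transversals as removing them evenly from three parts of size `σ`. -/
lemma cube_sub_cube_le {s₁ s₂ s₃ z₁ z₂ z₃ σ : ℝ} (hσ : 0 ≤ σ)
    (h₁ : σ ≤ s₁) (h₂ : σ ≤ s₂) (h₃ : σ ≤ s₃) (hz₁ : 0 ≤ z₁) (hz₂ : 0 ≤ z₂) (hz₃ : 0 ≤ z₃)
    (hs₁ : z₁ ≤ s₁) (hs₂ : z₂ ≤ s₂) (hs₃ : z₃ ≤ s₃) (hz : z₁ + z₂ + z₃ ≤ 3 * σ) :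
    27 * σ ^ 3 - (3 * σ - (z₁ + z₂ + z₃)) ^ 3 ≤
      27 * (s₁ * s₂ * s₃ - (s₁ - z₁) * (s₂ - z₂) * (s₃ - z₃)) := by
  have hcube : 0 ≤ (3 * σ - (z₁ + z₂ + z₃)) ^ 3 := pow_nonneg (by linarith) 3
  -- A part with more than `σ` removed elements suffices on its own.
  have hbig : ∀ a b c x y w : ℝ, σ ≤ a → σ ≤ b → σ ≤ c → σ ≤ x → x ≤ a → 0 ≤ y → y ≤ b →
      0 ≤ w → w ≤ c → σ ^ 3 ≤ a * b * c - (a - x) * (b - y) * (c - w) := by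
    intro a b c x y w ha hb hc hx hxa hy hyb hw hwc
    have e1 : (b - y) * (c - w) ≤ b * c := mul_le_mul (by linarith) (by linarith) (by linarith)
      (by linarith)
    have e2 : (a - x) * ((b - y) * (c - w)) ≤ (a - x) * (b * c) :=
      mul_le_mul_of_nonneg_left e1 (by linarith)
    have e3 : σ * σ ≤ b * c := mul_le_mul hb hc hσ (by linarith)
    have e4 : σ * (σ * σ) ≤ x * (b * c) := mul_le_mul hx e3 (by positivity) (by linarith)
    nlinarith
  by_cases c₁ : σ ≤ z₁
  · have := hbig s₁ s₂ s₃ z₁ z₂ z₃ h₁ h₂ h₃ c₁ hs₁ hz₂ hs₂ hz₃ hs₃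
    linarith
  by_cases c₂ : σ ≤ z₂
  · have := hbig s₂ s₁ s₃ z₂ z₁ z₃ h₂ h₁ h₃ c₂ hs₂ hz₁ hs₁ hz₃ hs₃
    linarith
  by_cases c₃ : σ ≤ z₃
  · have := hbig s₃ s₁ s₂ z₃ z₁ z₂ h₃ h₁ h₂ c₃ hs₃ hz₁ hs₁ hz₂ hs₂
    linarith
  push Not at c₁ c₂ c₃
  -- Otherwise all parts may be shrunk to size `σ`.
  have hmono : ∀ a a' b c x y w : ℝ, a ≤ a' → 0 ≤ y → y ≤ b → 0 ≤ w → w ≤ c →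
      a * b * c - (a - x) * (b - y) * (c - w) ≤ a' * b * c - (a' - x) * (b - y) * (c - w) := by
    intro a a' b c x y w ha hy hyb hw hwc
    have e1 : (b - y) * (c - w) ≤ b * c := mul_le_mul (by linarith) (by linarith) (by linarith)
      (by linarith)
    nlinarith [mul_nonneg (sub_nonneg.2 ha) (sub_nonneg.2 e1)]
  have e1 := hmono σ s₁ s₂ s₃ z₁ z₂ z₃ h₁ hz₂ hs₂ hz₃ hs₃
  have e2 := hmono σ s₂ σ s₃ z₂ z₁ z₃ h₂ hz₁ c₁.le hz₃ hs₃
  have e3 := hmono σ s₃ σ σ z₃ z₁ z₂ h₃ hz₁ c₁.le hz₂ c₂.le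
  have amgm : ∀ a b c : ℝ, 0 ≤ a → 0 ≤ b → 0 ≤ c → 27 * (a * b * c) ≤ (a + b + c) ^ 3 := by
    intro a b c ha hb hc
    nlinarith [mul_nonneg ha (sq_nonneg (b - c)), mul_nonneg hb (sq_nonneg (a - c)),
      mul_nonneg hc (sq_nonneg (a - b)), mul_nonneg (add_nonneg (add_nonneg ha hb) hc)
        (add_nonneg (add_nonneg (sq_nonneg (a - b)) (sq_nonneg (b - c))) (sq_nonneg (a - c)))]
  have e4 := amgm (σ - z₁) (σ - z₂) (σ - z₃) (by linarith) (by linarith) (by linarith)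
  have e5 : (σ - z₁ + (σ - z₂) + (σ - z₃)) ^ 3 = (3 * σ - (z₁ + z₂ + z₃)) ^ 3 := by ring
  linarith

/-- Four parts: a lower bound for the destroyed transversals `t` at a vertex, in terms of the
numbers `Y` and `∑ i, z i` of its exceptional neighbors inside and outside its own part. -/
lemma le_destroyed_of_four {ι : Type*} (S : Finset ι) (s z : ι → ℕ) {e t Y : ℕ}
    (hS : S.card = 3) (hs : ∀ i ∈ S, 3 * e ≤ 4 * s i) (hzs : ∀ i ∈ S, z i ≤ s i)
    (hze : Y + ∑ i ∈ S, z i ≤ e) (ht : ∏ i ∈ S, s i = t + ∏ i ∈ S, (s i - z i)) :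
    3 * Y ^ 2 * (∑ i ∈ S, z i) + 6 * Y * (∑ i ∈ S, z i) ^ 2 + (∑ i ∈ S, z i) ^ 3 ≤ 6 * t := by
  classical
  obtain ⟨a, b, c, hab, hac, hbc, rfl⟩ := card_eq_three.1 hS
  have hS3 : ∀ f : ι → ℕ, ∑ i ∈ {a, b, c}, f i = f a + f b + f c := fun f => by
    rw [sum_insert (by simp [hab, hac]), sum_pair hbc, add_assoc]
  have hP3 : ∀ f : ι → ℕ, ∏ i ∈ {a, b, c}, f i = f a * f b * f c := fun f => by
    rw [prod_insert (by simp [hab, hac]), prod_pair hbc, mul_assoc]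
  rw [hS3] at hze ⊢
  rw [hP3, hP3] at ht
  have ha := hs a (by simp)
  have hb := hs b (by simp)
  have hc := hs c (by simp)
  have hza := hzs a (by simp)
  have hzb := hzs b (by simp)
  have hzc := hzs c (by simp)
  generalize s a = s₁ at *
  generalize s b = s₂ at *
  generalize s c = s₃ at *
  generalize z a = z₁ at *
  generalize z b = z₂ at *
  generalize z c = z₃ at *
  obtain ⟨Z, hZ⟩ : ∃ Z : ℝ, Z = z₁ + z₂ + z₃ := ⟨_, rfl⟩
  have r1 : (3 * e / 4 : ℝ) ≤ s₁ := by
    have : (3 * e : ℝ) ≤ 4 * s₁ := by exact_mod_cast ha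
    linarith
  have r2 : (3 * e / 4 : ℝ) ≤ s₂ := by
    have : (3 * e : ℝ) ≤ 4 * s₂ := by exact_mod_cast hb
    linarith
  have r3 : (3 * e / 4 : ℝ) ≤ s₃ := by
    have : (3 * e : ℝ) ≤ 4 * s₃ := by exact_mod_cast hc
    linarith
  have r4 : (Y + Z : ℝ) ≤ e := by rw [hZ]; exact_mod_cast hze
  have hY0 : (0 : ℝ) ≤ Y := Nat.cast_nonneg _
  have hZ0 : (0 : ℝ) ≤ Z := by rw [hZ]; positivity
  have he0 : (0 : ℝ) ≤ e := Nat.cast_nonneg _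
  have h1 := cube_sub_cube_le (by positivity) r1 r2 r3 (Nat.cast_nonneg z₁) (Nat.cast_nonneg z₂)
    (Nat.cast_nonneg z₃) (by exact_mod_cast hza) (by exact_mod_cast hzb) (by exact_mod_cast hzc)
    (by rw [← hZ]; linarith)
  have h2 : (s₁ * s₂ * s₃ - (s₁ - z₁) * (s₂ - z₂) * (s₃ - z₃) : ℝ) = t := by
    have : (s₁ * s₂ * s₃ : ℝ) = t + (s₁ - z₁ : ℕ) * (s₂ - z₂ : ℕ) * (s₃ - z₃ : ℕ) := by
      exact_mod_cast ht
    rw [Nat.cast_sub hza, Nat.cast_sub hzb, Nat.cast_sub hzc] at this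
    linarith
  rw [h2, ← hZ] at h1
  have h3 : 3 * Y ^ 2 * Z + 6 * Y * Z ^ 2 + Z ^ 3 ≤ Z * (3 * (e : ℝ) ^ 2 - 2 * Z ^ 2) := by
    have : (Y : ℝ) ^ 2 + 2 * Y * Z ≤ e ^ 2 - Z ^ 2 := by nlinarith
    nlinarith [mul_le_mul_of_nonneg_left this hZ0]
  have h4 : Z * (3 * (e : ℝ) ^ 2 - 2 * Z ^ 2) ≤ 6 * t := by
    have h5 : 0 ≤ Z * (27 * (3 * e / 4 : ℝ) ^ 2 - 9 * (3 * e / 4) * Z + Z ^ 2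
        - 27 / 6 * (3 * (e : ℝ) ^ 2 - 2 * Z ^ 2)) :=
      mul_nonneg hZ0 (by nlinarith [sq_nonneg (Z - e / 3)])
    nlinarith
  have h6 : (3 * Y ^ 2 * (z₁ + z₂ + z₃) + 6 * Y * (z₁ + z₂ + z₃) ^ 2 + (z₁ + z₂ + z₃) ^ 3 : ℝ)
      ≤ 6 * t := by
    rw [← hZ]
    exact h3.trans h4
  exact_mod_cast h6

/-- Three parts, split as `b = y + z`: the transversals that are not contained in the subparts of
sizes `y`. -/
lemma prod_sub_prod_le_of_three {ι : Type*} (S : Finset ι) (y z : ι → ℕ) {M Y Z : ℕ}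
    (hS : S.card = 3) (hY : ∑ i ∈ S, y i = Y) (hZ : ∑ i ∈ S, z i = Z)
    (hM : M + ∏ i ∈ S, y i ≤ ∏ i ∈ S, (y i + z i)) :
    12 * M ≤ 3 * Y ^ 2 * Z + 3 * Y * Z ^ 2 + Z ^ 3 := by
  classical
  obtain ⟨a, b, c, hab, hac, hbc, rfl⟩ := card_eq_three.1 hS
  have hS3 : ∀ f : ι → ℕ, ∑ i ∈ {a, b, c}, f i = f a + f b + f c := fun f => by
    rw [sum_insert (by simp [hab, hac]), sum_pair hbc, add_assoc]
  have hP3 : ∀ f : ι → ℕ, ∏ i ∈ {a, b, c}, f i = f a * f b * f c := fun f => by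
    rw [prod_insert (by simp [hab, hac]), prod_pair hbc, mul_assoc]
  rw [hS3] at hY hZ
  rw [hP3, hP3] at hM
  subst hY hZ
  generalize y a = y₁ at *
  generalize y b = y₂ at *
  generalize y c = y₃ at *
  generalize z a = z₁ at *
  generalize z b = z₂ at *
  generalize z c = z₃ at *
  have four : ∀ u v w : ℕ, 4 * (u * v) ≤ (u + v + w) ^ 2 := fun u v w => by
    have h : (4 * (u * v) : ℤ) ≤ (u + v + w) ^ 2 := by
      have h2 : (0 : ℤ) ≤ (u + v) * w := by positivity
      nlinarith [sq_nonneg ((u : ℤ) - v), sq_nonneg (w : ℤ)]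
    exact_mod_cast h
  have t1 := Nat.mul_le_mul_left z₁ (four y₂ y₃ y₁)
  have t2 := Nat.mul_le_mul_left z₂ (four y₁ y₃ y₂)
  have t3 := Nat.mul_le_mul_left z₃ (four y₁ y₂ y₃)
  have u1 := Nat.mul_le_mul_left y₁ (four z₂ z₃ z₁)
  have u2 := Nat.mul_le_mul_left y₂ (four z₁ z₃ z₂)
  have u3 := Nat.mul_le_mul_left y₃ (four z₁ z₂ z₃)
  have w1 := Nat.mul_le_mul_left z₁ (four z₂ z₃ z₁)
  have w2 := Nat.mul_le_mul_left z₂ (four z₁ z₃ z₂)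
  have w3 := Nat.mul_le_mul_left z₃ (four z₁ z₂ z₃)
  nlinarith

/-! ### Role assignments and copies -/

section Roles

variable {ι V : Type*} [Fintype ι] [DecidableEq ι] [Fintype V] [DecidableEq V]

/-- A role assignment `a : V → V → ι` says that `v` plays the role `a v w` towards `w`. Its copies
are the tuples in which the `i`-th vertex plays the role `i` towards all the others. -/
def roleCopies (a : V → V → ι) : Finset (ι → V) :=
  univ.filter fun τ => ∀ i j, i ≠ j → a (τ i) (τ j) = i

/-- The vertices towards which `v` plays the role `i`. -/
def roleNbrs (a : V → V → ι) (v : V) (i : ι) : Finset V :=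
  univ.filter fun w => w ≠ v ∧ a v w = i

/-- The tuples whose entry `i` is `v` and whose entries `j ≠ i` belong to `S j`. -/
def pinned (i : ι) (v : V) (S : ι → Finset V) : Finset (ι → V) :=
  Fintype.piFinset fun j => if j = i then {v} else S j

lemma mem_roleCopies {a : V → V → ι} {τ : ι → V} :
    τ ∈ roleCopies a ↔ ∀ i j, i ≠ j → a (τ i) (τ j) = i := by
  simp [roleCopies]

lemma mem_roleNbrs {a : V → V → ι} {v w : V} {i : ι} :
    w ∈ roleNbrs a v i ↔ w ≠ v ∧ a v w = i := by
  simp [roleNbrs]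

lemma injective_of_mem_roleCopies {a : V → V → ι} {τ : ι → V} (h : τ ∈ roleCopies a) :
    Function.Injective τ := by
  intro i j hij
  by_contra hne
  rw [mem_roleCopies] at h
  have h1 := h i j hne
  have h2 := h j i (Ne.symm hne)
  rw [hij] at h1 h2
  exact hne (h1.symm.trans h2)

lemma mem_pinned {i : ι} {v : V} {S : ι → Finset V} {τ : ι → V} :
    τ ∈ pinned i v S ↔ τ i = v ∧ ∀ j ≠ i, τ j ∈ S j := by
  rw [pinned, Fintype.mem_piFinset]
  constructor
  · intro h
    refine ⟨by simpa using h i, fun j hj => ?_⟩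
    simpa [hj] using h j
  · rintro ⟨h1, h2⟩ j
    by_cases hj : j = i
    · simp [hj, h1]
    · simpa [hj] using h2 j hj

lemma card_pinned (i : ι) (v : V) (S : ι → Finset V) :
    (pinned i v S).card = ∏ j ∈ univ.erase i, (S j).card := by
  rw [pinned, Fintype.card_piFinset, ← mul_prod_erase univ _ (mem_univ i)]
  simp only [if_true, card_singleton, one_mul]
  exact prod_congr rfl fun j hj => by rw [if_neg (ne_of_mem_erase hj)]

/-- The tuples of `pinned i v S` that have an entry `j ≠ i` outside a given set. -/
lemma card_pinned_filter (i : ι) (v : V) (S : ι → Finset V) (Q : V → Prop) [DecidablePred Q] :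
    ((pinned i v S).filter fun τ => ∃ j, j ≠ i ∧ ¬ Q (τ j)).card
      + ∏ j ∈ univ.erase i, ((S j).filter Q).card = ∏ j ∈ univ.erase i, (S j).card := by
  rw [← card_pinned i v S, ← card_pinned i v fun j => (S j).filter Q,
    ← card_filter_add_card_filter_not (s := pinned i v S) fun τ => ∃ j, j ≠ i ∧ ¬ Q (τ j)]
  congr 2
  ext τ
  simp only [mem_filter, mem_pinned]
  push Not
  constructor
  · rintro ⟨h1, h2⟩
    exact ⟨⟨h1, fun j hj => (h2 j hj).1⟩, fun j hj => (h2 j hj).2⟩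
  · rintro ⟨⟨h1, h2⟩, h3⟩
    exact ⟨h1, fun j hj => ⟨h2 j hj, h3 j hj⟩⟩

lemma sum_card_fiber_le {T : Finset ι} (A : Finset V) (f : V → ι) :
    ∑ j ∈ T, (A.filter fun w => f w = j).card ≤ A.card := by
  rw [sum_card_fiberwise_eq_card_filter]
  exact card_filter_le _ _

lemma copies_at_subset_pinned (a : V → V → ι) (v : V) (i : ι) :
    ((roleCopies a).filter fun τ => τ i = v) ⊆
      pinned i v fun j => (roleNbrs a v i).filter fun w => a w v = j := by
  intro τ hτ
  rw [mem_filter] at hτ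
  obtain ⟨hτ, rfl⟩ := hτ
  rw [mem_pinned]
  refine ⟨rfl, fun j hj => ?_⟩
  rw [mem_filter, mem_roleNbrs]
  have hinj := injective_of_mem_roleCopies hτ
  rw [mem_roleCopies] at hτ
  exact ⟨⟨fun h => hj (hinj h), hτ i j hj.symm⟩, hτ j i hj⟩

/-- The vertices towards which `v` plays the role `i` are split by their own roles towards `v`, so
the copies with `v` in the role `i` are transversals of a multipartite structure. -/
lemma card_copies_at_le {m : ℕ} (hι : Fintype.card ι = m + 1) (a : V → V → ι) (v : V) (i : ι) :
    ((roleCopies a).filter fun τ => τ i = v).card ≤ balProd m (roleNbrs a v i).card := by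
  refine (card_le_card (copies_at_subset_pinned a v i)).trans ?_
  rw [card_pinned]
  refine (prod_le_balProd m (univ.erase i)
    (by rw [card_erase_of_mem (mem_univ i), card_univ, hι]; rfl) _).trans ?_
  exact balProd_mono m (sum_card_fiber_le _ _)

lemma sum_card_roleNbrs (a : V → V → ι) (v : V) (T : Finset ι) :
    ∑ i ∈ T, (roleNbrs a v i).card = (univ.filter fun w => w ≠ v ∧ a v w ∈ T).card := by
  have h := sum_card_fiberwise_eq_card_filter (univ.filter fun w => w ≠ v) T (a v)
  rw [filter_filter] at h
  rw [← h]
  refine sum_congr rfl fun i _ => ?_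
  rw [filter_filter]
  rfl

lemma card_roleCopies_le_avoid_add (a : V → V → ι) (v : V) : (roleCopies a).card ≤
    ((roleCopies a).filter fun τ => ∀ i, τ i ≠ v).card +
      ∑ i, ((roleCopies a).filter fun τ => τ i = v).card := by
  rw [← card_filter_add_card_filter_not (s := roleCopies a) fun τ => ∀ i, τ i ≠ v]
  refine Nat.add_le_add_left ?_ _
  refine le_trans (card_le_card ?_) card_biUnion_le
  intro τ hτ
  rw [mem_filter] at hτ
  obtain ⟨h1, h2⟩ := hτ
  push Not at h2
  obtain ⟨i, hi⟩ := h2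
  exact mem_biUnion.2 ⟨i, mem_univ i, mem_filter.2 ⟨h1, hi⟩⟩

/-- If deleting the vertex `v` leaves at most `blowupCount m n` copies, while there are more than
`blowupCount m (n + 1)` copies, then `v` plays one role towards all but fewer than `E` vertices. -/
lemma exists_dominant_role {m n E : ℕ} (hm : 0 < m) (hι : Fintype.card ι = m + 1)
    (hV : Fintype.card V = n + 1) (a : V → V → ι) (v : V) (hE : 2 * E ≤ n)
    (hsplit : balProd m (n - E) + balProd m E ≤ balProd m (n - n / (m + 1)))
    (hbig : blowupCount m (n + 1) < (roleCopies a).card)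
    (hmin : ((roleCopies a).filter fun τ => ∀ i, τ i ≠ v).card ≤ blowupCount m n) :
    ∃ i, (univ.filter fun w => w ≠ v ∧ a v w ≠ i).card < E := by
  by_contra hcon
  push Not at hcon
  have htot : (univ.filter fun w : V => w ≠ v).card = n := by
    rw [filter_ne' univ v, card_erase_of_mem (mem_univ v), card_univ, hV]
    rfl
  have hx : ∀ i, (roleNbrs a v i).card ≤ n - E := fun i => by
    have h1 := card_filter_add_card_filter_not (s := univ.filter fun w : V => w ≠ v)
      fun w => a v w = i
    rw [filter_filter, filter_filter, htot] at h1
    have h2 := hcon i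
    change (univ.filter fun w => w ≠ v ∧ a v w = i).card ≤ n - E
    change _ + (univ.filter fun w => w ≠ v ∧ a v w ≠ i).card = n at h1
    omega
  obtain ⟨c, hcm, hc⟩ := balProd_convex m hm
  have hsum : ∑ i, (roleNbrs a v i).card = n := by
    rw [sum_card_roleNbrs]
    simpa using htot
  have h3 := convex_majorize hc hcm (balProd_eq_zero hm) univ (fun i => (roleNbrs a v i).card)
    (fun i _ => hx i) E (by omega) (by rw [hsum]; omega)
  have h4 : ∑ i, ((roleCopies a).filter fun τ => τ i = v).card ≤
      ∑ i, balProd m (roleNbrs a v i).card :=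
    sum_le_sum fun i _ => card_copies_at_le hι a v i
  have h5 := card_roleCopies_le_avoid_add a v
  have h6 := gain_eq hm n
  rw [blowupCount_succ] at hbig
  omega

/-- Double counting of the pairs of a tuple in `A` and a position `i` whose entry `v` has
`d v ≠ i`. -/
lemma sum_card_filter_eq (d : V → ι) (A : Finset (ι → V)) (Q : (ι → V) → ι → Prop)
    [∀ τ i, Decidable (Q τ i)] :
    ∑ v, ∑ i ∈ univ.erase (d v), (A.filter fun τ => τ i = v ∧ Q τ i).card =
      ∑ τ ∈ A, (univ.filter fun i => d (τ i) ≠ i ∧ Q τ i).card := by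
  simp only [card_filter]
  have h1 : ∀ v, ∑ i ∈ univ.erase (d v), ∑ τ ∈ A, (if τ i = v ∧ Q τ i then 1 else 0)
      = ∑ τ ∈ A, ∑ i, if τ i = v ∧ d v ≠ i ∧ Q τ i then 1 else 0 := by
    intro v
    rw [sum_comm]
    refine sum_congr rfl fun τ _ => ?_
    rw [← filter_ne' univ (d v), sum_filter]
    refine sum_congr rfl fun i _ => ?_
    by_cases hi : i = d v
    · simp [hi]
    · simp [hi, Ne.symm hi]
  rw [sum_congr rfl fun v _ => h1 v, sum_comm]
  refine sum_congr rfl fun τ _ => ?_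
  rw [sum_comm]
  refine sum_congr rfl fun i _ => ?_
  rw [sum_eq_single (τ i)]
  · simp
  · intro v _ hv
    rw [if_neg fun h => hv h.1.symm]
  · intro h
    exact absurd (mem_univ _) h

/-- The exceptional vertices of `v` with respect to `d`: those towards which `v` does not play the
role `d v`. -/
def exceptional (a : V → V → ι) (d : V → ι) (v : V) : Finset V :=
  univ.filter fun w => w ≠ v ∧ a v w ≠ d v

/-- The copies in which some vertex `v` does not play its role `d v`: the other vertices of such a
copy are exceptional for `v`. -/
lemma card_nondominant_le {m : ℕ} (hm : 0 < m) (hι : Fintype.card ι = m + 1) (a : V → V → ι)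
    (d : V → ι) : ((roleCopies a).filter fun τ => ∃ i, d (τ i) ≠ i).card ≤
      ∑ v, balProd m (exceptional a d v).card := by
  have h1 : ((roleCopies a).filter fun τ => ∃ i, d (τ i) ≠ i).card ≤
      ∑ τ ∈ roleCopies a, (univ.filter fun i => d (τ i) ≠ i ∧ True).card := by
    rw [card_filter]
    refine sum_le_sum fun τ _ => ?_
    split_ifs with h
    · obtain ⟨i, hi⟩ := h
      exact card_pos.2 ⟨i, by simpa using hi⟩
    · exact Nat.zero_le _
  rw [← sum_card_filter_eq d (roleCopies a) fun _ _ => True] at h1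
  refine h1.trans (sum_le_sum fun v _ => ?_)
  obtain ⟨c, hcm, hc⟩ := balProd_convex m hm
  have h2 : (exceptional a d v).card = ∑ i ∈ univ.erase (d v), (roleNbrs a v i).card := by
    rw [sum_card_roleNbrs]
    simp [exceptional]
  rw [h2]
  refine le_trans (sum_le_sum fun i _ => ?_)
    (convex_sum_le hc hcm (balProd_eq_zero hm) _ fun i => (roleNbrs a v i).card)
  simpa using card_copies_at_le hι a v i

/-- The transversal copies: those in which every vertex plays its role `d`. -/
def transCopies (a : V → V → ι) (d : V → ι) : Finset (ι → V) :=
  (roleCopies a).filter fun τ => ∀ i, d (τ i) = i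

/-- The vertices with `d v = i`. -/
def part (d : V → ι) (i : ι) : Finset V := univ.filter fun v => d v = i

lemma mem_part {d : V → ι} {i : ι} {v : V} : v ∈ part d i ↔ d v = i := by simp [part]

/-- Exchange inequality. In a role assignment with the maximum number of copies, no vertex can gain
by playing the role `j` towards all other vertices, while they play their roles `d` towards it.
Averaging over all vertices bounds the part `j` from below. -/
lemma exchange {m : ℕ} (hι : Fintype.card ι = m + 1) (a : V → V → ι) (d : V → ι)
    (hmax : ∀ a' : V → V → ι, (roleCopies a').card ≤ (roleCopies a).card) (j : ι) :
    (transCopies a d).card * (Fintype.card V - m) ≤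
      (part d j).card * ((m + 1) * (roleCopies a).card) := by
  set X : Finset (ι → V) := univ.filter fun τ => ∀ i, i ≠ j →
    (τ i ≠ τ j ∧ d (τ i) = i ∧ ∀ l, l ≠ j → i ≠ l → a (τ i) (τ l) = i) with hX
  -- Redirecting `v` creates all tuples of `X` with entry `v` at `j`.
  have h1 : ∀ v, (X.filter fun τ => τ j = v).card ≤
      ∑ i, ((roleCopies a).filter fun τ => τ i = v).card := by
    intro v
    set a' : V → V → ι := fun u w => if u = v then j else if w = v then d u else a u w with ha'
    have hsub : ((roleCopies a).filter fun τ => ∀ i, τ i ≠ v) ∪ (X.filter fun τ => τ j = v) ⊆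
        roleCopies a' := by
      intro τ hτ
      rw [mem_union, mem_filter, mem_filter] at hτ
      rw [mem_roleCopies]
      intro i l hil
      rcases hτ with ⟨h2, h3⟩ | ⟨h2, h3⟩
      · rw [mem_roleCopies] at h2
        simp only [ha', if_neg (h3 i), if_neg (h3 l)]
        exact h2 i l hil
      · rw [hX, mem_filter] at h2
        have h2 := h2.2
        by_cases hi : i = j
        · subst hi
          simp [ha', h3]
        · have h4 : τ i ≠ v := h3 ▸ (h2 i hi).1
          by_cases hl : l = j
          · subst hl
            simp only [ha', if_neg h4, h3, if_true]
            exact (h2 i hi).2.1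
          · have h5 : τ l ≠ v := h3 ▸ (h2 l hl).1
            simp only [ha', if_neg h4, if_neg h5]
            exact (h2 i hi).2.2 l hl hil
    have hdisj : Disjoint ((roleCopies a).filter fun τ => ∀ i, τ i ≠ v)
        (X.filter fun τ => τ j = v) := by
      rw [disjoint_left]
      intro τ h2 h3
      exact (mem_filter.1 h2).2 j (mem_filter.1 h3).2
    have h2 := (card_le_card hsub).trans (hmax a')
    rw [card_union_of_disjoint hdisj] at h2
    have h3 := card_roleCopies_le_avoid_add a v
    omega
  have h2 : X.card ≤ (m + 1) * (roleCopies a).card := by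
    rw [card_eq_sum_card_fiberwise (f := fun τ : ι → V => τ j) (t := univ) fun _ _ => mem_univ _]
    refine (sum_le_sum fun v _ => h1 v).trans ?_
    rw [sum_comm, ← hι, ← card_univ, ← smul_eq_mul]
    refine sum_le_card_nsmul _ _ _ fun i _ => ?_
    exact (card_eq_sum_card_fiberwise fun _ _ => mem_univ _).ge
  -- Replacing the entry `j` of a transversal copy by an unused vertex gives a tuple of `X`.
  have h3 : (transCopies a d).card * (Fintype.card V - m) ≤ (X ×ˢ part d j).card := by
    have h4 : (transCopies a d).card * (Fintype.card V - m) ≤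
        ((transCopies a d).sigma fun τ => ((univ.erase j).image τ)ᶜ).card := by
      rw [card_sigma, ← smul_eq_mul]
      refine card_nsmul_le_sum _ _ _ fun τ _ => ?_
      rw [card_compl]
      have h5 : ((univ.erase j).image τ).card ≤ (univ.erase j).card := card_image_le
      rw [card_erase_of_mem (mem_univ j), card_univ, hι] at h5
      omega
    refine h4.trans (card_le_card_of_injOn (fun x => (Function.update x.1 j x.2, x.1 j)) ?_ ?_)
    · rintro ⟨τ, v⟩ hx
      rw [mem_coe, mem_sigma] at hx
      obtain ⟨h5, h6⟩ := hx
      rw [transCopies, mem_filter, mem_roleCopies] at h5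
      simp only [mem_compl, mem_image, mem_erase, mem_univ, and_true, not_exists, not_and] at h6
      rw [mem_coe, mem_product, mem_part]
      refine ⟨?_, h5.2 j⟩
      rw [hX, mem_filter]
      refine ⟨mem_univ _, fun i hi => ?_⟩
      dsimp only
      rw [Function.update_of_ne hi, Function.update_self]
      refine ⟨h6 i hi, h5.2 i, fun l hl hil => ?_⟩
      rw [Function.update_of_ne hl]
      exact h5.1 i l hil
    · rintro ⟨τ, v⟩ _ ⟨τ', v'⟩ _ heq
      simp only [Prod.mk.injEq] at heq
      obtain ⟨h5, h6⟩ := heq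
      have hv : v = v' := by simpa using congrFun h5 j
      have hτ : τ = τ' := by
        funext i
        by_cases hi : i = j
        · rw [hi, h6]
        · simpa [hi] using congrFun h5 i
      rw [hv, hτ]
  rw [card_product, mul_comm X.card] at h3
  exact h3.trans (Nat.mul_le_mul_left _ h2)

end Roles

section Roles

variable {ι V : Type*} [Fintype ι] [DecidableEq ι] [Fintype V] [DecidableEq V]

/-! ### Transversals and mixed copies -/

/-- The transversals that are not copies. -/
def badTransversals (a : V → V → ι) (d : V → ι) : Finset (ι → V) :=
  univ.filter fun τ => (∀ i, d (τ i) = i) ∧ τ ∉ roleCopies a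

/-- The transversals through `v` that contain a vertex towards which `v` fails to play its
role `d v`. -/
def destroyed (a : V → V → ι) (d : V → ι) (v : V) : Finset (ι → V) :=
  univ.filter fun τ => (∀ i, d (τ i) = i) ∧ τ (d v) = v ∧ ∃ j, j ≠ d v ∧ ¬ a v (τ j) = d v

/-- The copies that are neither transversal nor contained in a single part. -/
def mixedCopies (a : V → V → ι) (d : V → ι) : Finset (ι → V) :=
  (roleCopies a).filter fun τ => (∃ i, d (τ i) ≠ i) ∧ ∃ i j, d (τ i) ≠ d (τ j)

lemma card_transCopies_add_card_bad (a : V → V → ι) (d : V → ι) :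
    (transCopies a d).card + (badTransversals a d).card = ∏ i, (part d i).card := by
  rw [← Fintype.card_piFinset,
    ← card_filter_add_card_filter_not (s := Fintype.piFinset (part d)) fun τ => τ ∈ roleCopies a]
  congr 2
  · ext τ
    simp only [transCopies, mem_filter, Fintype.mem_piFinset, mem_part]
    tauto
  · ext τ
    simp only [badTransversals, mem_filter, Fintype.mem_piFinset, mem_part, mem_univ, true_and]

/-- A bad transversal is destroyed at no more than one vertex for each of its entries. -/
lemma sum_card_destroyed_le (a : V → V → ι) (d : V → ι) :
    ∑ v, (destroyed a d v).card ≤ Fintype.card ι * (badTransversals a d).card := by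
  have h1 : ∀ v, (destroyed a d v).card ≤
      ((badTransversals a d).filter fun τ => τ (d v) = v).card := by
    intro v
    refine card_le_card fun τ hτ => ?_
    rw [destroyed, mem_filter] at hτ
    obtain ⟨-, h2, h3, j, hj, h4⟩ := hτ
    rw [mem_filter, badTransversals, mem_filter]
    refine ⟨⟨mem_univ _, h2, fun h => h4 ?_⟩, h3⟩
    have := mem_roleCopies.1 h (d v) j hj.symm
    rwa [h3] at this
  refine (sum_le_sum fun v _ => h1 v).trans ?_
  simp only [card_filter]
  rw [sum_comm, mul_comm, ← smul_eq_mul]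
  refine sum_le_card_nsmul _ _ _ fun τ _ => ?_
  rw [← card_filter, ← card_univ]
  refine card_le_card_of_injOn d (fun _ _ => mem_coe.2 (mem_univ _)) ?_
  intro v hv w hw h
  rw [mem_coe, mem_filter] at hv hw
  rw [← hv.2, ← hw.2, h]

lemma card_destroyed (a : V → V → ι) (d : V → ι) (v : V) :
    ∏ j ∈ univ.erase (d v), (part d j).card = (destroyed a d v).card +
      ∏ j ∈ univ.erase (d v),
        ((part d j).card - ((part d j).filter fun w => a v w ≠ d v).card) := by
  rw [← card_pinned_filter (d v) v (part d) fun w => a v w = d v]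
  congr 1
  · congr 1
    ext τ
    simp only [destroyed, mem_filter, mem_pinned, mem_part, mem_univ, true_and]
    constructor
    · rintro ⟨⟨h1, h2⟩, h3⟩
      refine ⟨fun i => ?_, h1, h3⟩
      by_cases hi : i = d v
      · rw [hi, h1]
      · exact h2 i hi
    · rintro ⟨h1, h2, h3⟩
      exact ⟨⟨h2, fun j _ => h1 j⟩, h3⟩
  · refine prod_congr rfl fun j _ => ?_
    have := card_filter_add_card_filter_not (s := part d j) fun w => a v w = d v
    change _ + ((part d j).filter fun w => a v w ≠ d v).card = _ at this
    omega

/-- The exceptional vertices of `v` in its own part. -/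
def innerExceptional (a : V → V → ι) (d : V → ι) (v : V) : Finset V :=
  (exceptional a d v).filter fun w => d w = d v

/-- The exceptional vertices of `v` in other parts. -/
def outerExceptional (a : V → V → ι) (d : V → ι) (v : V) : Finset V :=
  (exceptional a d v).filter fun w => ¬ d w = d v

lemma card_inner_add_card_outer (a : V → V → ι) (d : V → ι) (v : V) :
    (innerExceptional a d v).card + (outerExceptional a d v).card = (exceptional a d v).card :=
  card_filter_add_card_filter_not _

lemma sum_card_part_filter (a : V → V → ι) (d : V → ι) (v : V) :
    ∑ j ∈ univ.erase (d v), ((part d j).filter fun w => a v w ≠ d v).card =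
      (outerExceptional a d v).card := by
  have h := sum_card_fiberwise_eq_card_filter
    (univ.filter fun w => a v w ≠ d v) (univ.erase (d v)) d
  have e : outerExceptional a d v = (univ.filter fun w => a v w ≠ d v).filter
      fun w => d w ∈ univ.erase (d v) := by
    ext w
    simp only [outerExceptional, exceptional, mem_filter, mem_univ, true_and, mem_erase, and_true]
    constructor
    · tauto
    · rintro ⟨h1, h2⟩
      exact ⟨⟨fun h => h2 (h ▸ rfl), h1⟩, h2⟩
  rw [e, ← h]
  refine sum_congr rfl fun j _ => ?_
  rw [part, filter_filter, filter_filter]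
  congr 1
  ext w
  simp only [mem_filter]
  tauto

lemma sum_card_roleNbrs_filter (a : V → V → ι) (d : V → ι) (v : V) (Q : V → Prop)
    [DecidablePred Q] : ∑ i ∈ univ.erase (d v), ((roleNbrs a v i).filter Q).card =
      ((exceptional a d v).filter Q).card := by
  have h := sum_card_fiberwise_eq_card_filter
    ((univ.filter fun w => w ≠ v).filter Q) (univ.erase (d v)) (a v)
  have e : (exceptional a d v).filter Q = ((univ.filter fun w => w ≠ v).filter Q).filter
      fun w => a v w ∈ univ.erase (d v) := by
    ext w
    simp only [exceptional, mem_filter, mem_univ, true_and, mem_erase, and_true]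
    tauto
  rw [e, ← h]
  refine sum_congr rfl fun i _ => ?_
  rw [roleNbrs]
  congr 1
  ext w
  simp only [mem_filter]
  tauto

/-- The mixed copies with `v` in the role `i ≠ d v`: all other vertices are exceptional for `v`, and
one of them lies outside the part of `v`. -/
lemma card_mixed_at_add_le (a : V → V → ι) (d : V → ι) (v : V) (i : ι) :
    ((mixedCopies a d).filter fun τ => τ i = v ∧ True).card +
        ∏ l ∈ univ.erase i, (((roleNbrs a v i).filter fun w => a w v = l).filter
          fun w => d w = d v).card ≤
      ∏ l ∈ univ.erase i, ((roleNbrs a v i).filter fun w => a w v = l).card := by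
  rw [← card_pinned_filter i v (fun l => (roleNbrs a v i).filter fun w => a w v = l)
    fun w => d w = d v]
  refine Nat.add_le_add_right (card_le_card fun τ hτ => ?_) _
  rw [mem_filter, mixedCopies, mem_filter] at hτ
  obtain ⟨⟨h1, -, j, l, hjl⟩, h2, -⟩ := hτ
  refine mem_filter.2 ⟨copies_at_subset_pinned a v i (mem_filter.2 ⟨h1, h2⟩), ?_⟩
  by_contra hcon
  push Not at hcon
  have hall : ∀ j, d (τ j) = d v := fun j => by
    by_cases hj : j = i
    · rw [hj, h2]
    · exact hcon j hj
  exact hjl ((hall j).trans (hall l).symm)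

/-- The copies with `v` in the role `i ≠ d v` in which all other vertices play their roles `d`. -/
lemma card_single_at_le (a : V → V → ι) (d : V → ι) (v : V) {i : ι} (hi : i ≠ d v) :
    ((mixedCopies a d).filter fun τ => τ i = v ∧ ∀ l, l ≠ i → d (τ l) = l).card ≤
      ((roleNbrs a v i).filter fun w => d w = d v).card *
        ∏ l ∈ (univ.erase i).erase (d v), ((roleNbrs a v i).filter fun w => d w = l).card := by
  rw [mul_prod_erase (univ.erase i) (fun l => ((roleNbrs a v i).filter fun w => d w = l).card)
    (mem_erase.2 ⟨hi.symm, mem_univ _⟩), ← card_pinned i v]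
  refine card_le_card fun τ hτ => ?_
  rw [mem_filter, mixedCopies, mem_filter] at hτ
  obtain ⟨⟨h1, -⟩, h2, h3⟩ := hτ
  have h4 := mem_pinned.1 (copies_at_subset_pinned a v i (mem_filter.2 ⟨h1, h2⟩))
  rw [mem_pinned]
  exact ⟨h2, fun l hl => mem_filter.2 ⟨(mem_filter.1 (h4.2 l hl)).1, h3 l hl⟩⟩

/-- Every mixed copy has a vertex playing a role other than its role `d`; count a copy with a single
such vertex twice. -/
lemma two_mul_card_mixed_le (a : V → V → ι) (d : V → ι) : 2 * (mixedCopies a d).card ≤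
    ∑ v, ∑ i ∈ univ.erase (d v), (((mixedCopies a d).filter fun τ => τ i = v ∧ True).card +
      ((mixedCopies a d).filter fun τ => τ i = v ∧ ∀ l, l ≠ i → d (τ l) = l).card) := by
  simp only [sum_add_distrib]
  rw [sum_card_filter_eq d _ fun _ _ => True,
    sum_card_filter_eq d _ fun τ i => ∀ l, l ≠ i → d (τ l) = l, ← sum_add_distrib,
    mul_comm, ← smul_eq_mul]
  refine card_nsmul_le_sum _ _ _ fun τ hτ => ?_
  rw [mixedCopies, mem_filter] at hτ
  obtain ⟨-, ⟨i, hi⟩, -⟩ := hτ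
  have hi1 : i ∈ univ.filter fun i => d (τ i) ≠ i ∧ True := by simpa using hi
  by_cases h : ∃ l, l ≠ i ∧ d (τ l) ≠ l
  · obtain ⟨l, hl, hdl⟩ := h
    have hl1 : l ∈ univ.filter fun i => d (τ i) ≠ i ∧ True := by simpa using hdl
    have := one_lt_card.2 ⟨l, hl1, i, hi1, hl⟩
    omega
  · push Not at h
    have h1 := card_pos.2 ⟨i, hi1⟩
    have h2 : 0 < (univ.filter fun i => d (τ i) ≠ i ∧ ∀ l, l ≠ i → d (τ l) = l).card :=
      card_pos.2 ⟨i, mem_filter.2 ⟨mem_univ _, hi, h⟩⟩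
    omega

lemma card_mixed_le (a : V → V → ι) (d : V → ι) : (mixedCopies a d).card ≤
    ∑ v, ∑ i ∈ univ.erase (d v), ((mixedCopies a d).filter fun τ => τ i = v ∧ True).card := by
  rw [sum_card_filter_eq d _ fun _ _ => True, card_eq_sum_ones]
  refine sum_le_sum fun τ hτ => ?_
  rw [mixedCopies, mem_filter] at hτ
  obtain ⟨-, ⟨i, hi⟩, -⟩ := hτ
  exact card_pos.2 ⟨i, by simpa using hi⟩

/-- A bound for the number `M` of tuples whose entries lie in sets of sizes `y l + z l` and at least
one of which lies in a prescribed subset of size `z l`. -/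
lemma pow_mul_le_of_add_prod_le {S : Finset ι} {y z : ι → ℕ} {M e Z : ℕ}
    (hM : M + ∏ l ∈ S, y l ≤ ∏ l ∈ S, (y l + z l)) (he : ∑ l ∈ S, (y l + z l) ≤ e)
    (hZ : ∑ l ∈ S, z l ≤ Z) : (S.card - 1) ^ (S.card - 1) * M ≤ Z * e ^ (S.card - 1) := by
  have h1 : ∀ T : Finset ι, ∏ l ∈ T, (y l + z l) ≤
      ∏ l ∈ T, y l + ∑ l ∈ T, z l * ∏ j ∈ T.erase l, (y j + z j) := by
    intro T
    induction T using Finset.induction_on with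
    | empty => simp
    | insert b T hb ih =>
      rw [prod_insert hb, prod_insert hb, sum_insert hb, erase_insert hb, add_mul]
      have h2 : ∑ l ∈ T, z l * ∏ j ∈ (insert b T).erase l, (y j + z j) =
          (y b + z b) * ∑ l ∈ T, z l * ∏ j ∈ T.erase l, (y j + z j) := by
        rw [mul_sum]
        refine sum_congr rfl fun l hl => ?_
        have hne : b ≠ l := fun h => hb (h ▸ hl)
        rw [erase_insert_of_ne hne, prod_insert (fun h => hb (mem_of_mem_erase h))]
        ring
      rw [h2]
      have h3 := Nat.mul_le_mul_left (y b) ih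
      have h4 := Nat.mul_le_mul_right (∑ l ∈ T, z l * ∏ j ∈ T.erase l, (y j + z j))
        (Nat.le_add_right (y b) (z b))
      rw [mul_add] at h3
      linarith
  have h2 : M ≤ ∑ l ∈ S, z l * ∏ j ∈ S.erase l, (y j + z j) := by
    have := h1 S
    omega
  calc (S.card - 1) ^ (S.card - 1) * M
      ≤ (S.card - 1) ^ (S.card - 1) * ∑ l ∈ S, z l * ∏ j ∈ S.erase l, (y j + z j) :=
        Nat.mul_le_mul_left _ h2
    _ = ∑ l ∈ S, z l * ((S.card - 1) ^ (S.card - 1) * ∏ j ∈ S.erase l, (y j + z j)) := by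
        rw [mul_sum]
        exact sum_congr rfl fun l _ => by ring
    _ ≤ ∑ l ∈ S, z l * e ^ (S.card - 1) := by
        refine sum_le_sum fun l hl => Nat.mul_le_mul_left _ ?_
        have h3 := pow_mul_prod_le (S.erase l) fun j => y j + z j
        rw [card_erase_of_mem hl] at h3
        refine h3.trans (Nat.pow_le_pow_left (le_trans ?_ he) _)
        exact sum_le_sum_of_subset (erase_subset _ _)
    _ = (∑ l ∈ S, z l) * e ^ (S.card - 1) := (sum_mul _ _ _).symm
    _ ≤ _ := Nat.mul_le_mul_right _ hZ

/-- With at least five roles, the transversals that are not copies outnumber the mixed copies. -/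
lemma card_mixed_le_card_bad_of_five_le {m e : ℕ} (hm : 4 ≤ m) (hι : Fintype.card ι = m + 1)
    (a : V → V → ι) (d : V → ι) (he : 0 < e) (hexc : ∀ v, (exceptional a d v).card ≤ e)
    (hpart : ∀ i, 4 * e ≤ 5 * (part d i).card) :
    (mixedCopies a d).card ≤ (badTransversals a d).card := by
  have hcard : ∀ i : ι, (univ.erase i).card = m := fun i => by
    rw [card_erase_of_mem (mem_univ i), card_univ, hι]
    rfl
  have key : ∀ v, (m + 1) *
      ∑ i ∈ univ.erase (d v), ((mixedCopies a d).filter fun τ => τ i = v ∧ True).card ≤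
        (destroyed a d v).card := by
    intro v
    have h0 := card_inner_add_card_outer a d v
    have h1 := hexc v
    have h2 : (m - 1) ^ (m - 1) *
        ∑ i ∈ univ.erase (d v), ((mixedCopies a d).filter fun τ => τ i = v ∧ True).card ≤
          (outerExceptional a d v).card * e ^ (m - 1) := by
      rw [outerExceptional, ← sum_card_roleNbrs_filter a d v, mul_sum, sum_mul]
      refine sum_le_sum fun i hi => ?_
      have hsplit : ∀ l, ((roleNbrs a v i).filter fun w => a w v = l).card =
          (((roleNbrs a v i).filter fun w => a w v = l).filter fun w => d w = d v).card +
          (((roleNbrs a v i).filter fun w => a w v = l).filter fun w => ¬ d w = d v).card :=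
        fun l => (card_filter_add_card_filter_not _).symm
      have h3 := card_mixed_at_add_le a d v i
      rw [prod_congr rfl fun l _ => hsplit l] at h3
      have h4 := pow_mul_le_of_add_prod_le h3 (e := e)
        (Z := ((roleNbrs a v i).filter fun w => ¬ d w = d v).card) ?_ ?_
      · rwa [hcard] at h4
      · rw [← sum_congr rfl fun l _ => hsplit l]
        refine (sum_card_fiber_le _ _).trans (le_trans (card_le_card ?_) h1)
        intro w hw
        rw [mem_roleNbrs] at hw
        rw [exceptional, mem_filter]
        exact ⟨mem_univ _, hw.1, by rw [hw.2]; exact ne_of_mem_erase hi⟩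
      · simp only [filter_filter, and_comm (b := ¬ d _ = d v)]
        simp only [← filter_filter]
        exact sum_card_fiber_le _ _
    have h3 := mul_le_destroyed_of_five_le (univ.erase (d v)) (fun j => (part d j).card)
      (fun j => ((part d j).filter fun w => a v w ≠ d v).card) (by rw [hcard]; exact hm) he
      (fun j _ => hpart j) (fun j _ => card_filter_le _ _)
      (by rw [sum_card_part_filter]; omega) (card_destroyed a d v)
      (by rw [hcard, sum_card_part_filter]; exact h2)
    rwa [hcard] at h3
  have h1 := card_mixed_le a d
  have h2 := sum_le_sum fun v (_ : v ∈ univ) => key v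
  rw [← mul_sum] at h2
  have h3 := sum_card_destroyed_le a d
  rw [hι] at h3
  exact Nat.le_of_mul_le_mul_left (((Nat.mul_le_mul_left _ h1).trans h2).trans h3) (by omega)

/-- With four roles, the transversals that are not copies outnumber the mixed copies. -/
lemma card_mixed_le_card_bad_of_four {e : ℕ} (hι : Fintype.card ι = 4)
    (a : V → V → ι) (d : V → ι) (hexc : ∀ v, (exceptional a d v).card ≤ e)
    (hpart : ∀ i, 3 * e ≤ 4 * (part d i).card) :
    (mixedCopies a d).card ≤ (badTransversals a d).card := by
  have hcard : ∀ i : ι, (univ.erase i).card = 3 := fun i => by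
    rw [card_erase_of_mem (mem_univ i), card_univ, hι]
  have key : ∀ v, 2 *
      ∑ i ∈ univ.erase (d v), (((mixedCopies a d).filter fun τ => τ i = v ∧ True).card +
        ((mixedCopies a d).filter fun τ => τ i = v ∧ ∀ l, l ≠ i → d (τ l) = l).card) ≤
        (destroyed a d v).card := by
    intro v
    have h0 := card_inner_add_card_outer a d v
    have h1 := hexc v
    set Y := (innerExceptional a d v).card with hY
    set Z := (outerExceptional a d v).card with hZ
    set y : ι → ℕ := fun i => ((roleNbrs a v i).filter fun w => d w = d v).card with hy
    set z : ι → ℕ := fun i => ((roleNbrs a v i).filter fun w => ¬ d w = d v).card with hz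
    have hyY : ∑ i ∈ univ.erase (d v), y i = Y := sum_card_roleNbrs_filter a d v _
    have hzZ : ∑ i ∈ univ.erase (d v), z i = Z := sum_card_roleNbrs_filter a d v _
    have h2 : ∀ i ∈ univ.erase (d v),
        12 * (((mixedCopies a d).filter fun τ => τ i = v ∧ True).card +
        ((mixedCopies a d).filter fun τ => τ i = v ∧ ∀ l, l ≠ i → d (τ l) = l).card) ≤
        3 * Y ^ 2 * z i + 6 * y i * Z ^ 2 + z i * Z ^ 2 := by
      intro i hi
      have hyi : y i ≤ Y := hyY ▸ single_le_sum (fun _ _ => Nat.zero_le _) hi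
      have hzi : z i ≤ Z := hzZ ▸ single_le_sum (fun _ _ => Nat.zero_le _) hi
      -- Copies with `v` in the role `i`.
      have hsplit : ∀ l, ((roleNbrs a v i).filter fun w => a w v = l).card =
          (((roleNbrs a v i).filter fun w => a w v = l).filter fun w => d w = d v).card +
          (((roleNbrs a v i).filter fun w => a w v = l).filter fun w => ¬ d w = d v).card :=
        fun l => (card_filter_add_card_filter_not _).symm
      have h3 := card_mixed_at_add_le a d v i
      rw [prod_congr rfl fun l _ => hsplit l] at h3
      have h4 := prod_sub_prod_le_of_three _ _ _ (hcard i) rfl rfl h3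
      have hY' : ∑ l ∈ univ.erase i, (((roleNbrs a v i).filter fun w => a w v = l).filter
          fun w => d w = d v).card ≤ y i := by
        simp only [filter_filter, and_comm (b := d _ = d v)]
        simp only [← filter_filter]
        exact sum_card_fiber_le _ _
      have hZ' : ∑ l ∈ univ.erase i, (((roleNbrs a v i).filter fun w => a w v = l).filter
          fun w => ¬ d w = d v).card ≤ z i := by
        simp only [filter_filter, and_comm (b := ¬ d _ = d v)]
        simp only [← filter_filter]
        exact sum_card_fiber_le _ _
      have h5 : 12 * ((mixedCopies a d).filter fun τ => τ i = v ∧ True).card ≤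
          3 * (y i) ^ 2 * z i + 3 * y i * (z i) ^ 2 + (z i) ^ 3 := by
        refine h4.trans ?_
        gcongr
      -- Copies with all other vertices in their roles `d`.
      have h6 := card_single_at_le a d v (ne_of_mem_erase hi)
      have hc2 : ((univ.erase i).erase (d v)).card = 2 := by
        rw [card_erase_of_mem (mem_erase.2 ⟨(ne_of_mem_erase hi).symm, mem_univ _⟩), hcard]
      have h7 := pow_mul_prod_le ((univ.erase i).erase (d v))
        fun l => ((roleNbrs a v i).filter fun w => d w = l).card
      rw [hc2] at h7
      have h8 : ∑ l ∈ (univ.erase i).erase (d v), ((roleNbrs a v i).filter fun w => d w = l).card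
          ≤ z i := by
        rw [sum_card_fiberwise_eq_card_filter]
        refine card_le_card fun w hw => ?_
        rw [mem_filter] at hw ⊢
        exact ⟨hw.1, ne_of_mem_erase hw.2⟩
      have h9 := h7.trans (Nat.pow_le_pow_left h8 2)
      have h10 : 4 * ((mixedCopies a d).filter fun τ => τ i = v ∧
          ∀ l, l ≠ i → d (τ l) = l).card ≤ y i * z i ^ 2 := by
        calc _ ≤ 4 * (y i * ∏ l ∈ (univ.erase i).erase (d v),
              ((roleNbrs a v i).filter fun w => d w = l).card) := Nat.mul_le_mul_left _ h6
          _ = y i * (2 ^ 2 * ∏ l ∈ (univ.erase i).erase (d v),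
              ((roleNbrs a v i).filter fun w => d w = l).card) := by ring
          _ ≤ _ := Nat.mul_le_mul_left _ h9
      have m1 : y i ^ 2 * z i ≤ Y ^ 2 * z i := by gcongr
      have m2 : y i * z i ^ 2 ≤ y i * Z ^ 2 := by gcongr
      have m3 : z i ^ 3 ≤ z i * Z ^ 2 := by
        rw [show z i ^ 3 = z i * z i ^ 2 by ring]
        gcongr
      nlinarith
    have h3 := sum_le_sum h2
    have hsum : ∑ i ∈ univ.erase (d v), (3 * Y ^ 2 * z i + 6 * y i * Z ^ 2 + z i * Z ^ 2) =
        3 * Y ^ 2 * Z + 6 * Y * Z ^ 2 + Z * Z ^ 2 := by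
      rw [sum_add_distrib, sum_add_distrib, ← mul_sum, ← sum_mul, ← mul_sum, ← sum_mul, hyY, hzZ]
    rw [← mul_sum, hsum] at h3
    have h4 := le_destroyed_of_four (univ.erase (d v)) (fun j => (part d j).card)
      (fun j => ((part d j).filter fun w => a v w ≠ d v).card) (Y := Y) (hcard _)
      (fun j _ => hpart j) (fun j _ => card_filter_le _ _)
      (by rw [sum_card_part_filter, ← hZ]; omega) (card_destroyed a d v)
    rw [sum_card_part_filter, ← hZ] at h4
    have e1 : Z ^ 3 = Z * Z ^ 2 := by ring
    omega
  have h1 := two_mul_card_mixed_le a d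
  have h2 := sum_le_sum fun v (_ : v ∈ univ) => key v
  rw [← mul_sum] at h2
  have h3 := sum_card_destroyed_le a d
  rw [hι] at h3
  omega

end Roles

/-! ### The bound for role assignments -/

section Step

variable {ι V : Type*} [Fintype ι] [DecidableEq ι] [Fintype V] [DecidableEq V]

lemma sum_card_part (d : V → ι) : ∑ i, (part d i).card = Fintype.card V := by
  rw [← card_univ]
  exact (card_eq_sum_card_fiberwise fun _ _ => mem_univ _).symm

lemma card_roleCopies_le_trans_add (a : V → V → ι) (d : V → ι) : (roleCopies a).card ≤
    (transCopies a d).card + ((roleCopies a).filter fun τ => ∃ i, d (τ i) ≠ i).card := by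
  rw [← card_filter_add_card_filter_not (s := roleCopies a) fun τ => ∀ i, d (τ i) = i]
  refine Nat.add_le_add_left (card_le_card fun τ hτ => ?_) _
  rw [mem_filter] at hτ ⊢
  push Not at hτ
  exact hτ

lemma card_roleCopies_le_trans_add_inner_add_mixed (a : V → V → ι) (d : V → ι) :
    (roleCopies a).card ≤ (transCopies a d).card +
      ∑ c, ((roleCopies a).filter fun τ => ∀ i, τ i ∈ part d c).card + (mixedCopies a d).card := by
  have hsub : roleCopies a ⊆ (transCopies a d ∪
      univ.biUnion fun c => (roleCopies a).filter fun τ => ∀ i, τ i ∈ part d c) ∪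
        mixedCopies a d := by
    intro τ hτ
    simp only [transCopies, mixedCopies, mem_union, mem_filter, mem_biUnion, mem_univ, true_and,
      mem_part, hτ]
    by_cases h1 : ∀ i, d (τ i) = i
    · exact Or.inl (Or.inl h1)
    by_cases h2 : ∃ i j, d (τ i) ≠ d (τ j)
    · push Not at h1
      exact Or.inr ⟨h1, h2⟩
    · push Not at h1 h2
      obtain ⟨i, -⟩ := h1
      exact Or.inl (Or.inr ⟨d (τ i), fun j => h2 j i⟩)
  refine (card_le_card hsub).trans ((card_union_le _ _).trans (Nat.add_le_add_right ?_ _))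
  exact (card_union_le _ _).trans (Nat.add_le_add_left card_biUnion_le _)

/-- The inductive step: a role assignment with the maximum number of copies, all of whose proper
restrictions satisfy the bound. -/
lemma card_roleCopies_le_of_max {m n : ℕ} (hm : 3 ≤ m) (hι : Fintype.card ι = m + 1)
    (hV : Fintype.card V = n + 1) (hn : m ≤ n) (a : V → V → ι)
    (hmin : ∀ U : Finset V, U ≠ univ →
      ((roleCopies a).filter fun τ => ∀ i, τ i ∈ U).card ≤ blowupCount m U.card)
    (hmax : ∀ a' : V → V → ι, (roleCopies a').card ≤ (roleCopies a).card) :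
    (roleCopies a).card ≤ blowupCount m (n + 1) := by
  by_contra hbig
  push Not at hbig
  have havoid : ∀ v, ((roleCopies a).filter fun τ => ∀ i, τ i ≠ v).card ≤ blowupCount m n := by
    intro v
    have h1 := hmin (univ.erase v) fun h =>
      notMem_erase v univ (by rw [h]; exact mem_univ v)
    rw [card_erase_of_mem (mem_univ v), card_univ, hV, Nat.add_sub_cancel] at h1
    simpa using h1
  have hparts := sum_card_part (ι := ι) (V := V)
  rw [hV] at hparts
  have hcov := fun d : V → ι => card_roleCopies_le_trans_add a d
  rcases lt_or_ge (n / (m + 1)) m with hq | hq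
  · -- There are too few exceptional vertices for copies that are not transversal.
    obtain ⟨h2E, hsplit⟩ := balProd_split_le_of_small hm hn hq
    choose d hd using fun v =>
      exists_dominant_role (by omega) hι hV a v h2E hsplit hbig (havoid v)
    have h1 := card_nondominant_le (by omega) hι a d
    have h2 : ∑ v, balProd m (exceptional a d v).card = 0 := sum_eq_zero fun v _ => by
      have := hd v
      exact balProd_eq_zero (by rw [exceptional]; omega)
    have h3 := card_transCopies_add_card_bad a d
    have h4 := prod_le_balProd (m + 1) univ (by rw [card_univ, hι]) fun i => (part d i).card
    rw [hparts d] at h4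
    have h5 := balProd_le_blowupCount (m := m) (by omega) (n + 1)
    have h6 := hcov d
    omega
  · obtain ⟨h2E, hsplit⟩ := balProd_split_le hm hq
    choose d hd using fun v =>
      exists_dominant_role (by omega) hι hV a v h2E hsplit hbig (havoid v)
    obtain ⟨q, hqdef⟩ : ∃ q, q = n / (m + 1) := ⟨_, rfl⟩
    rw [← hqdef] at hq hd
    obtain ⟨e, he⟩ : ∃ e, e = q + q / 20 := ⟨_, rfl⟩
    have hexc : ∀ v, (exceptional a d v).card ≤ e := fun v => by
      have := hd v
      rw [exceptional]
      omega
    have hT : (roleCopies a).card ≤ (transCopies a d).card + (n + 1) * balProd m (q + q / 20) := by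
      refine (hcov d).trans (Nat.add_le_add_left ?_ _)
      refine (card_nondominant_le (by omega) hι a d).trans ?_
      rw [← hV, ← card_univ, ← smul_eq_mul]
      exact sum_le_card_nsmul _ _ _ fun v _ => balProd_mono m (he ▸ hexc v)
    have hN : balProd (m + 1) (n + 1) ≤ (roleCopies a).card :=
      (balProd_le_blowupCount (by omega) _).trans hbig.le
    have hx := exchange hι a d hmax
    rw [hV] at hx
    have hn' : n < (m + 1) * (q + 1) := by
      rw [hqdef]
      exact Nat.lt_mul_div_succ n (by omega)
    -- Lower bounds for the parts, and their consequences.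
    obtain ⟨hpos, hhalf, hmixed⟩ : (∀ i, 0 < (part d i).card) ∧
        (∀ i, 2 * (part d i).card ≤ n + 1 + 2) ∧
        (mixedCopies a d).card ≤ (badTransversals a d).card := by
      have hsplit_sum : ∀ i, (part d i).card + ∑ j ∈ univ.erase i, (part d j).card = n + 1 :=
        fun i => (add_sum_erase univ (fun j => (part d j).card) (mem_univ i)).trans (hparts d)
      have hcard : ∀ i : ι, (univ.erase i).card = m := fun i => by
        rw [card_erase_of_mem (mem_univ i), card_univ, hι]
        rfl
      rcases Nat.eq_or_lt_of_le hm with rfl | hm4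
      · have hp : ∀ i, 3 * e ≤ 4 * (part d i).card := fun i =>
          he ▸ part_size_four hqdef hq hN hT (hx i)
        refine ⟨fun i => by have := hp i; omega, fun i => ?_,
          card_mixed_le_card_bad_of_four hι a d hexc hp⟩
        have h1 : (univ.erase i).card • ((3 * e + 3) / 4) ≤ ∑ j ∈ univ.erase i, (part d j).card :=
          card_nsmul_le_sum _ _ _ fun j _ => by have := hp j; omega
        rw [hcard, smul_eq_mul] at h1
        have h2 := hsplit_sum i
        have hqe : q ≤ e := he ▸ Nat.le_add_right _ _
        have h3 : 3 ≤ (3 * e + 3) / 4 := by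
          rw [Nat.le_div_iff_mul_le (by omega)]
          omega
        have h4 : 3 * q ≤ 4 * ((3 * e + 3) / 4) := by
          have := Nat.div_add_mod (3 * e + 3) 4
          have := Nat.mod_lt (3 * e + 3) (show 4 > 0 by omega)
          omega
        generalize (3 * e + 3) / 4 = w at h1 h3 h4
        rcases Nat.lt_or_ge q 5 with h5 | h5
        · have h6 : n < 20 := hn'.trans_le (by omega)
          omega
        · linarith
      · have hp : ∀ i, 4 * e ≤ 5 * (part d i).card := fun i =>
          he ▸ part_size_of_five_le hm4 hqdef hq hN hT (hx i)
        refine ⟨fun i => by have := hp i; omega, fun i => ?_,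
          card_mixed_le_card_bad_of_five_le hm4 hι a d (by omega) hexc hp⟩
        have h1 : (univ.erase i).card • (4 * e) ≤ ∑ j ∈ univ.erase i, 5 * (part d j).card :=
          card_nsmul_le_sum _ _ _ fun j _ => hp j
        rw [hcard, smul_eq_mul, ← mul_sum] at h1
        have h2 := hsplit_sum i
        have h3 : m * (4 * q) ≤ m * (4 * e) := Nat.mul_le_mul_left _ (by omega)
        have h4 : 5 * ((m + 1) * (q + 1)) ≤ 8 * (m * q) + 10 := by nlinarith
        have h5 : m * (4 * q) = 4 * (m * q) := by ring
        omega
    have h1 := card_roleCopies_le_trans_add_inner_add_mixed a d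
    have h2 := card_transCopies_add_card_bad a d
    have h3 : ∑ c, ((roleCopies a).filter fun τ => ∀ i, τ i ∈ part d c).card ≤
        ∑ c, blowupCount m (part d c).card := by
      refine sum_le_sum fun c _ => hmin _ fun hc => ?_
      obtain ⟨c', hc'⟩ : ∃ c', c' ≠ c :=
        have : Nontrivial ι := Fintype.one_lt_card_iff_nontrivial.1 (by omega)
        exists_ne c
      obtain ⟨w, hw⟩ := card_pos.1 (hpos c')
      have hw' : w ∈ part d c := hc ▸ mem_univ w
      rw [mem_part] at hw hw'
      exact hc' (hw.symm.trans hw')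
    have h4 := sum_blowupCount_add_prod_le (by omega) hι (n + 1) (fun i => (part d i).card)
      (hparts d) hhalf
    omega

end Step

universe u

/-- The number of copies in a role assignment on `s` vertices with `m + 1 ≥ 4` roles. -/
lemma card_roleCopies_le {ι : Type*} [Fintype ι] [DecidableEq ι] {m : ℕ} (hm : 3 ≤ m)
    (hι : Fintype.card ι = m + 1) (s : ℕ) : ∀ {V : Type u} [Fintype V] [DecidableEq V],
    Fintype.card V = s → ∀ a : V → V → ι, (roleCopies a).card ≤ blowupCount m s := by
  induction s using Nat.strong_induction_on with
  | _ s ih =>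
    intro V _ _ hV a
    by_cases hs : s ≤ m
    · have : roleCopies a = ∅ := by
        refine eq_empty_of_forall_notMem fun τ hτ => ?_
        have := Fintype.card_le_of_injective τ (injective_of_mem_roleCopies hτ)
        omega
      rw [this, card_empty]
      exact Nat.zero_le _
    obtain ⟨n, rfl⟩ : ∃ n, s = n + 1 := ⟨s - 1, by omega⟩
    have : Nonempty (V → V → ι) := ⟨a⟩
    obtain ⟨b, hb⟩ := Finite.exists_max fun a : V → V → ι => (roleCopies a).card
    refine (hb a).trans (card_roleCopies_le_of_max hm hι hV (by omega) b ?_ hb)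
    intro U hU
    have hlt : U.card < n + 1 := by
      rw [← hV, ← card_univ]
      exact card_lt_card (ssubset_univ_iff.2 hU)
    refine le_trans ?_ (ih U.card hlt (V := U) (by simp) fun v w => b v w)
    have hinj : Function.Injective fun (σ : ι → U) (i : ι) => (σ i : V) := fun σ σ' h =>
      funext fun i => Subtype.ext (congrFun h i)
    rw [← card_map ⟨_, hinj⟩]
    refine card_le_card fun τ hτ => ?_
    rw [mem_filter, mem_roleCopies] at hτ
    rw [mem_map]
    refine ⟨fun i => ⟨τ i, hτ.2 i⟩, ?_, rfl⟩
    rw [mem_roleCopies]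
    exact hτ.1

/-! ### From colored tournaments to role assignments -/

namespace ColoredTournament

variable {W V C : Type*}

/-- The edge `v w` of `H` has the color of an edge of `R` at `x`, and is oriented so that `v`
corresponds to `x`. -/
def Matches (R : ColoredTournament W C) (H : ColoredTournament V C) (v w : V) (x : W) : Prop :=
  ∃ (y : W) (hxy : x ≠ y) (hvw : v ≠ w), R.color.get x y hxy = H.color.get v w hvw ∧
    (R.digraph.Adj x y ↔ H.digraph.Adj v w)

lemma Matches.unique {R : ColoredTournament W C} (hR : R.IsRainbow) {H : ColoredTournament V C}
    {v w : V} {x x' : W} (h : R.Matches H v w x) (h' : R.Matches H v w x') : x = x' := by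
  obtain ⟨y, hxy, hvw, hc, ho⟩ := h
  obtain ⟨y', hxy', _, hc', ho'⟩ := h'
  have h1 := congrArg Subtype.val (hR (hc.trans hc'.symm))
  rcases Sym2.eq_iff.1 h1 with ⟨h2, -⟩ | ⟨h2, h3⟩
  · exact h2
  · subst h2 h3
    have h4 := R.isTournament.oriented x y hxy
    have h5 := ho.trans ho'.symm
    rw [xor_iff_not_iff] at h4
    exact absurd h5 h4

open Classical in
/-- The role assignment of `H`: the role of `v` towards `w` is the vertex of `R` matched to `v` by
the color and the orientation of the edge `v w`, if there is one. -/
noncomputable def role [Nonempty W] (R : ColoredTournament W C) (H : ColoredTournament V C)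
    (v w : V) : W :=
  if h : ∃ x, R.Matches H v w x then h.choose else Classical.arbitrary W

lemma role_eq [Nonempty W] {R : ColoredTournament W C} (hR : R.IsRainbow)
    {H : ColoredTournament V C} {v w : V} {x : W} (h : R.Matches H v w x) :
    R.role H v w = x := by
  have hex : ∃ x, R.Matches H v w x := ⟨x, h⟩
  rw [role, dif_pos hex]
  exact hex.choose_spec.unique hR h

/-- Every copy is the range of a tuple in `roleCopies`. -/
lemma ncard_copies_le [Fintype W] [DecidableEq W] [Nonempty W] [Fintype V] [DecidableEq V]
    {R : ColoredTournament W C} (hR : R.IsRainbow) (H : ColoredTournament V C) :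
    (R.copies H).ncard ≤ (roleCopies (R.role H)).card := by
  rw [← Set.ncard_coe_finset]
  refine le_trans (Set.ncard_le_ncard ?_ ((finite_toSet _).image Set.range))
    (Set.ncard_image_le (finite_toSet _))
  rintro S ⟨f, hadj, hcol⟩
  refine ⟨fun x => (f x : V), ?_, ?_⟩
  · rw [mem_coe, mem_roleCopies]
    intro x y hxy
    refine role_eq hR ⟨y, hxy, fun h => hxy (f.injective (Subtype.ext h)), ?_, hadj x y⟩
    exact (hcol x y hxy).symm
  · ext v
    constructor
    · rintro ⟨x, rfl⟩
      exact (f x).2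
    · intro hv
      exact ⟨f.symm ⟨v, hv⟩, by simp⟩

end ColoredTournament

theorem theorem3 {W V : Type*} [Fintype W] [Fintype V] (k s : ℕ) (hk : 4 ≤ k) (hs : k ≤ s)
    (hW : Fintype.card W = k) (hV : Fintype.card V = s)
    (R : ColoredTournament W (PairColor k)) (hR : R.IsRainbow)
    (H : ColoredTournament V (PairColor k)) :
    (R.copies H).ncard ≤ erdosHajnalG k s := by
  classical
  obtain ⟨m, rfl⟩ : ∃ m, k = m + 1 := ⟨k - 1, by omega⟩
  have : Nonempty W := Fintype.card_pos_iff.1 (by omega)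
  exact (ColoredTournament.ncard_copies_le hR H).trans
    ((card_roleCopies_le (by omega) hW s hV _).trans (blowupCount_le_erdosHajnalG (by omega) s))
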